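/- Let $\mathbf k$ be a finite field with $q$ elements and $v=\sqrt q$. Let $Q$ be the quiver $1\xrightarrow{\alpha}2\xleftarrow{\beta}3$ with the involution $\tau$ that swaps $1$ and $3$ (and $\alpha$ and $\beta$) and fixes $2$. Let $\Lambda$ be the path algebra over $\mathbf k$ of the quiver with vertices $i,i'$ ($i\in Q_0$) and arrows $\gamma:i\to j$, $\gamma':i'\to j'$ (for each arrow $\gamma:i\to j$ of $Q$), $\varepsilon_i:i\to i'$ and $\varepsilon_i':i'\to i$ ($i\in Q_0$), modulo the relations $\varepsilon_i\varepsilon_i'=0=\varepsilon_i'\varepsilon_i$ ($i\in Q_0$) and $\varepsilon_j\gamma=\gamma'\varepsilon_i$, $\varepsilon_j'\gamma'=\gamma\varepsilon_i'$ (for each arrow $\gamma:i\to j$ of $Q$). Let $\Lambda^\imath$ be the subalgebra of $\Lambda$ fixed by the involution $i\mapsto(\tau i)'$, $i'\mapsto\tau i$, $\gamma\mapsto(\tau\gamma)'$, $\gamma'\mapsto\tau\gamma$, $\varepsilon_i\mapsto\varepsilon'_{\tau i}$, $\varepsilon'_i\mapsto\varepsilon_{\tau i}$. Equivalently, $\Lambda^\imath$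 is given by the quiver $Q$ with additional arrows $\varepsilon_1:1\to3$, $\varepsilon_3:3\to1$, $\varepsilon_2:2\to2$ and the relations $\varepsilon_1\varepsilon_3=\varepsilon_3\varepsilon_1=0$, $\varepsilon_2^2=0$, $\varepsilon_2\beta=\alpha\varepsilon_3$, $\varepsilon_2\alpha=\beta\varepsilon_1$. Let $\mathcal A=\operatorname{mod}(\Lambda^\imath)$ be the category of finite-dimensional $\Lambda^\imath$-modules, let $S_i$ be the one-dimensional simple module at the vertex $i$, and let $\mathbb E_2=\mathbf k[\varepsilon_2]/(\varepsilon_2^2)$, supported at the vertex $2$. The Ringel-Hall algebra $\mathcal H(\mathcal A)$ has as basis the isomorphism classes $[M]$ of objects of $\mathcal A$, with product $$[M]\diamond[N]=\sum_{[L]}\frac{|\operatorname{Ext}^1(M,N)_L|}{|\operatorname{Hom}(M,N)|}\,[L],$$ where $\operatorname{Ext}^1(M,N)_L$ is the set of extension classes with middle term isomorphic to $L$. Let $I$ be the two-sided ideal generated by the differences $[M]-[N]$ such that $M$ and $N$ have the same class in $K_0(\mathcal A)$ and are isomorphic in the singularity category of $\mathcal A$, which is the Verdier quotient of $D^b(\mathcal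 A)$ by the thick subcategory generated by the objects of finite projective dimension. The $\imath$Hall algebra $\widetilde{\mathcal H}(\mathbf kQ,\tau)$ is the $\mathbb Q(v)$-algebra obtained from $\mathcal H(\mathcal A)/I$ by inverting the classes $[K]$ of the objects $K$ of projective dimension at most $1$, with the twisted product $$[M]*[N]=v^{\langle \operatorname{res}M,\operatorname{res}N\rangle_Q}\,[M]\diamond[N],$$ where $\operatorname{res}M$ is the restriction of $M$ to $\mathbf kQ\subset\Lambda^\imath$ and $\langle\cdot,\cdot\rangle_Q$ is the Euler form of $Q$. Then, for $i=1,3$, the following identities hold in $\widetilde{\mathcal H}(\mathbf kQ,\tau)$: $$[S_i]*[S_i]*[S_2]-(v+v^{-1})[S_i]*[S_2]*[S_i]+[S_2]*[S_i]*[S_i]=0,$$ $$[S_2]*[S_2]*[S_i]-(v+v^{-1})[S_2]*[S_i]*[S_2]+[S_i]*[S_2]*[S_2]=-\frac{(q-1)^2}{v}\,[S_i]*[\mathbb E_2].$$ -/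

import Mathlib

open CategoryTheory CategoryTheory.Limits

universe u

noncomputable section

/-! ## Bound quiver algebras -/

/-- A quiver with vertex set `V` and arrow set `A`. -/
structure FinQuiver (V A : Type) where
  src : A → V
  tgt : A → V

namespace FinQuiver

variable {V A : Type} [Fintype V] (Q : FinQuiver V A) (k : Type u) [Field k]

/-- The free algebra on the trivial paths `e i` and the arrows of a quiver. -/
abbrev Free (_Q : FinQuiver V A) (k : Type u) [Field k] : Type u := FreeAlgebra k (V ⊕ A)

/-- The trivial path at the vertex `i`. -/
def vtx (i : V) : Q.Free k := FreeAlgebra.ι k (Sum.inl i)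

/-- The arrow `a`. -/
def arr (a : A) : Q.Free k := FreeAlgebra.ι k (Sum.inr a)

/-- The defining relations of `kQ / (R)`. Paths are composed like maps: `b * a` is the path
`a` followed by `b`, so that left modules are representations of the quiver. -/
inductive BoundRel (R : Q.Free k → Q.Free k → Prop) : Q.Free k → Q.Free k → Prop
  | idem (i : V) : BoundRel R (Q.vtx k i * Q.vtx k i) (Q.vtx k i)
  | orth (i j : V) (h : i ≠ j) : BoundRel R (Q.vtx k i * Q.vtx k j) 0
  | one : BoundRel R (∑ i, Q.vtx k i) 1
  | tgt (a : A) : BoundRel R (Q.vtx k (Q.tgt a) * Q.arr k a) (Q.arr k a)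
  | src (a : A) : BoundRel R (Q.arr k a * Q.vtx k (Q.src a)) (Q.arr k a)
  | rel (x y : Q.Free k) (h : R x y) : BoundRel R x y

/-- The algebra `kQ / (x - y : R x y)`. -/
abbrev BoundAlg (R : Q.Free k → Q.Free k → Prop) : Type u := RingQuot (Q.BoundRel k R)

end FinQuiver

/-! ## iquivers and iquiver algebras -/

/-- A finite quiver with an involution `τ` (an automorphism of the quiver with `τ² = Id`). -/
structure IQuiver (V A : Type) extends FinQuiver V A where
  τ : V → V
  τA : A → A
  τ_τ : ∀ i, τ (τ i) = i
  τA_τA : ∀ a, τA (τA a) = a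
  src_τA : ∀ a, src (τA a) = τ (src a)
  tgt_τA : ∀ a, tgt (τA a) = τ (tgt a)

namespace IQuiver

variable {V A : Type}

/-- The double framed quiver `Q♯`. The vertex `i` is `(i, false)` and the vertex `i'` is
`(i, true)`; the arrow `α` is `inl (α, false)` and `α'` is `inl (α, true)`; the arrow
`ε_i : i → i'` is `inr (i, false)` and `ε'_i : i' → i` is `inr (i, true)`. -/
def sharp (Q : IQuiver V A) : FinQuiver (V × Bool) ((A × Bool) ⊕ (V × Bool)) where
  src := Sum.elim (fun x => (Q.src x.1, x.2)) (fun x => x)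
  tgt := Sum.elim (fun x => (Q.tgt x.1, x.2)) (fun x => (x.1, !x.2))

theorem sharp_src_inl (Q : IQuiver V A) (a : A) (b : Bool) : Q.sharp.src (Sum.inl (a, b)) = (Q.src a, b) := rfl

theorem sharp_src_inr (Q : IQuiver V A) (i : V) (b : Bool) : Q.sharp.src (Sum.inr (i, b)) = (i, b) := rfl

theorem sharp_tgt_inl (Q : IQuiver V A) (a : A) (b : Bool) : Q.sharp.tgt (Sum.inl (a, b)) = (Q.tgt a, b) := rfl

theorem sharp_tgt_inr (Q : IQuiver V A) (i : V) (b : Bool) : Q.sharp.tgt (Sum.inr (i, b)) = (i, !b) := rfl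

variable [Fintype V] (Q : IQuiver V A) (k : Type u) [Field k]

/-- The nilpotent relations `ε_i' ε_i = 0 = ε_i ε_i'` and the commutative relations
`ε_j α = α' ε_i`, `ε_j' α' = α ε_i'` for `α : i → j`. -/
inductive SharpRel : Q.sharp.Free k → Q.sharp.Free k → Prop
  | nil (i : V) (b : Bool) :
      SharpRel (Q.sharp.arr k (Sum.inr (i, !b)) * Q.sharp.arr k (Sum.inr (i, b))) 0
  | comm (a : A) (b : Bool) :
      SharpRel (Q.sharp.arr k (Sum.inr (Q.tgt a, b)) * Q.sharp.arr k (Sum.inl (a, b)))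
        (Q.sharp.arr k (Sum.inl (a, !b)) * Q.sharp.arr k (Sum.inr (Q.src a, b)))

/-- The algebra `Λ = kQ♯ / I♯`, isomorphic to `kQ ⊗ R₂`. -/
abbrev Lam : Type u := Q.sharp.BoundAlg k (Q.SharpRel k)

/-- The quotient map onto `Λ`. -/
abbrev toLam : Q.sharp.Free k →ₐ[k] Q.Lam k :=
  RingQuot.mkAlgHom k (Q.sharp.BoundRel k (Q.SharpRel k))

/-- The action of `τ♯` on the vertices and arrows of `Q♯`. -/
def sharpGen : (V × Bool) ⊕ ((A × Bool) ⊕ (V × Bool)) → (V × Bool) ⊕ ((A × Bool) ⊕ (V × Bool))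
  | Sum.inl (i, b) => Sum.inl (Q.τ i, !b)
  | Sum.inr (Sum.inl (a, b)) => Sum.inr (Sum.inl (Q.τA a, !b))
  | Sum.inr (Sum.inr (i, b)) => Sum.inr (Sum.inr (Q.τ i, !b))

/-- `τ♯` on the free algebra, followed by the projection to `Λ`. -/
def tauFree : Q.sharp.Free k →ₐ[k] Q.Lam k :=
  FreeAlgebra.lift k fun x => Q.toLam k (FreeAlgebra.ι k (Q.sharpGen x))

theorem toLam_rel {x y : Q.sharp.Free k} (h : Q.sharp.BoundRel k (Q.SharpRel k) x y) :
    Q.toLam k x = Q.toLam k y := RingQuot.mkAlgHom_rel k h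

theorem tauFree_vtx (i : V) (b : Bool) :
    Q.tauFree k (Q.sharp.vtx k (i, b)) = Q.toLam k (Q.sharp.vtx k (Q.τ i, !b)) := by
  simp [tauFree, FinQuiver.vtx, sharpGen]

theorem tauFree_arr (a : A) (b : Bool) :
    Q.tauFree k (Q.sharp.arr k (Sum.inl (a, b))) =
      Q.toLam k (Q.sharp.arr k (Sum.inl (Q.τA a, !b))) := by
  simp [tauFree, FinQuiver.arr, sharpGen]

theorem tauFree_eps (i : V) (b : Bool) :
    Q.tauFree k (Q.sharp.arr k (Sum.inr (i, b))) =
      Q.toLam k (Q.sharp.arr k (Sum.inr (Q.τ i, !b))) := by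
  simp [tauFree, FinQuiver.arr, sharpGen]

theorem tauFree_rel {x y : Q.sharp.Free k} (h : Q.sharp.BoundRel k (Q.SharpRel k) x y) :
    Q.tauFree k x = Q.tauFree k y := by
  cases h with
  | idem i =>
    obtain ⟨i, b⟩ := i
    rw [map_mul, tauFree_vtx, ← map_mul]
    exact Q.toLam_rel k (.idem _)
  | orth i j h =>
    obtain ⟨i, b⟩ := i
    obtain ⟨j, c⟩ := j
    rw [map_mul, tauFree_vtx, tauFree_vtx, ← map_mul, map_zero, ← map_zero (Q.toLam k)]
    refine Q.toLam_rel k (.orth _ _ fun e => h ?_)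
    simp only [Prod.mk.injEq, Bool.not_inj_iff] at e ⊢
    exact ⟨by rw [← Q.τ_τ i, e.1, Q.τ_τ], e.2⟩
  | one =>
    have h1 : Q.tauFree k (∑ i, Q.sharp.vtx k i) = Q.toLam k (∑ i, Q.sharp.vtx k i) := by
      rw [map_sum, map_sum]
      refine Fintype.sum_bijective (fun x : V × Bool => (Q.τ x.1, !x.2)) ?_ _ _
        (fun x => Q.tauFree_vtx k x.1 x.2)
      exact Function.Involutive.bijective fun x => by simp [Q.τ_τ]
    rw [h1, map_one, ← map_one (Q.toLam k)]
    exact Q.toLam_rel k .one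
  | tgt a =>
    rcases a with ⟨a, b⟩ | ⟨i, b⟩
    · have := Q.toLam_rel k (.tgt (Sum.inl (Q.τA a, !b)))
      simp only [sharp_tgt_inl, Q.tgt_τA, map_mul] at this
      rw [sharp_tgt_inl, map_mul, tauFree_vtx, tauFree_arr, this]
    · have := Q.toLam_rel k (.tgt (Sum.inr (Q.τ i, !b)))
      simp only [sharp_tgt_inr, map_mul] at this
      rw [sharp_tgt_inr, map_mul, tauFree_vtx, tauFree_eps, this]
  | src a =>
    rcases a with ⟨a, b⟩ | ⟨i, b⟩
    · have := Q.toLam_rel k (.src (Sum.inl (Q.τA a, !b)))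
      simp only [sharp_src_inl, Q.src_τA, map_mul] at this
      rw [sharp_src_inl, map_mul, tauFree_vtx, tauFree_arr, this]
    · have := Q.toLam_rel k (.src (Sum.inr (Q.τ i, !b)))
      simp only [sharp_src_inr, map_mul] at this
      rw [sharp_src_inr, map_mul, tauFree_vtx, tauFree_eps, this]
  | rel x y h =>
    cases h with
    | nil i b =>
      have := Q.toLam_rel k (.rel _ _ (.nil (Q.τ i) (!b)))
      simpa [tauFree_eps] using this
    | comm a b =>
      have := Q.toLam_rel k (.rel _ _ (.comm (Q.τA a) (!b)))
      simpa [tauFree_eps, tauFree_arr, Q.src_τA, Q.tgt_τA] using this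

/-- The involution `τ♯` of the algebra `Λ`. -/
def tauSharp : Q.Lam k →ₐ[k] Q.Lam k :=
  RingQuot.liftAlgHom k ⟨Q.tauFree k, fun _ _ h => Q.tauFree_rel k h⟩

/-- The iquiver algebra `Λ^ı`: the fixed point subalgebra of `Λ` under `τ♯`. -/
def iAlg : Subalgebra k (Q.Lam k) := AlgHom.equalizer (Q.tauSharp k) (AlgHom.id k (Q.Lam k))

/-- The primitive idempotent of `Λ^ı` at the vertex `i`, which is the image of `e_i` under the
embedding of `kQ` in `Λ^ı`: in `Λ` it is the sum of the trivial paths at `i` and at `(τ i)'`. -/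
def idem (i : V) : Q.iAlg k :=
  ⟨Q.toLam k (Q.sharp.vtx k (i, false)) + Q.toLam k (Q.sharp.vtx k (Q.τ i, true)), by
    simp only [iAlg, AlgHom.mem_equalizer, tauSharp, map_add, AlgHom.id_apply, toLam,
      RingQuot.liftAlgHom_mkAlgHom_apply, tauFree_vtx, Q.τ_τ]
    simp [add_comm]⟩

/-! ## Finite-dimensional modules over the iquiver algebra -/

open scoped ModuleCat in
/-- The finite-dimensional modules. (If `Q` is acyclic, then every finite-dimensional
`Λ^ı`-module is nilpotent.) -/
def isFinDim : ObjectProperty (ModuleCat.{u} (Q.iAlg k)) := fun M => Module.Finite k M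

open scoped ModuleCat in
instance : (Q.isFinDim k).IsSerreClass where
  exists_zero := ⟨ModuleCat.of _ PUnit, ModuleCat.isZero_of_subsingleton _,
    (inferInstance : Module.Finite k (ModuleCat.of (Q.iAlg k) PUnit.{u + 1}))⟩
  prop_of_mono {X Y} f _ hY := by
    have : Module.Finite k Y := hY
    exact Module.Finite.of_injective (f.hom.restrictScalars k)
      ((ModuleCat.mono_iff_injective f).1 inferInstance)
  prop_of_epi {X Y} f _ hX := by
    have : Module.Finite k X := hX
    exact Module.Finite.of_surjective (f.hom.restrictScalars k)
      ((ModuleCat.epi_iff_surjective f).1 inferInstance)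
  prop_X₂_of_shortExact {S} hS h₁ h₃ := by
    have : Module.Finite k S.X₁ := h₁
    have : Module.Finite k S.X₃ := h₃
    exact Module.Finite.of_exact (f := S.f.hom.restrictScalars k) (g := S.g.hom.restrictScalars k)
      ((ShortComplex.ShortExact.moduleCat_exact_iff_function_exact S).1 hS.exact)
      ((ModuleCat.epi_iff_surjective S.g).1 hS.epi_g)

instance : (Q.isFinDim k).IsClosedUnderFiniteProducts :=
  have : (Q.isFinDim k).IsClosedUnderBinaryProducts :=
    { limitsOfShape_le := by
        rintro X ⟨h⟩
        have h1 := (Q.isFinDim k).prop_biprod (h.prop_diag_obj ⟨WalkingPair.left⟩)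
          (h.prop_diag_obj ⟨WalkingPair.right⟩)
        exact (Q.isFinDim k).prop_of_iso
          (IsLimit.conePointsIsoOfNatIso (BinaryBiproduct.isLimit _ _) h.isLimit
            (diagramIsoPair h.diag).symm) h1 }
  ObjectProperty.IsClosedUnderFiniteProducts.mk'

/-- The category `mod(Λ^ı)` of finite-dimensional `Λ^ı`-modules. -/
abbrev Mod : Type (u + 1) := (Q.isFinDim k).FullSubcategory

open scoped ModuleCat in
/-- The dimension vector of the restriction of `M` to `kQ`: `dim_k (e_i M)`. -/
def dimVec (M : Q.Mod k) (i : V) : ℕ :=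
  Module.finrank k (LinearMap.range (Algebra.lsmul k k M.obj (Q.idem k i)))

/-- The Euler form of the quiver `Q`,
`⟨x, y⟩ = ∑_{i ∈ Q₀} x_i y_i - ∑_{α ∈ Q₁} x_{src α} y_{tgt α}`. -/
def eulerForm [Fintype A] (x y : V → ℤ) : ℤ :=
  ∑ i, x i * y i - ∑ a, x (Q.src a) * y (Q.tgt a)

/-- `⟨res M, res N⟩_Q`. -/
def eulerRes [Fintype A] (M N : Q.Mod k) : ℤ :=
  Q.eulerForm (fun i => (Q.dimVec k M i : ℤ)) (fun i => (Q.dimVec k N i : ℤ))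

section Rep

variable {k} (W : Type u) [AddCommGroup W] [Module k W]

/-- The `Λ^ı`-module that is the restriction of the representation of `Q♯` on `W` in which the
vertices and arrows act by `g`. -/
def ofRep (g : (V × Bool) ⊕ ((A × Bool) ⊕ (V × Bool)) → Module.End k W)
    (hg : ∀ ⦃x y⦄, Q.sharp.BoundRel k (Q.SharpRel k) x y →
      FreeAlgebra.lift k g x = FreeAlgebra.lift k g y) : ModuleCat.{u} (Q.iAlg k) :=
  (ModuleCat.restrictScalars
    (((RingQuot.liftAlgHom k ⟨FreeAlgebra.lift k g, hg⟩).comp (Q.iAlg k).val).toRingHom)).obj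
    (ModuleCat.of (Module.End k W) W)

open scoped ModuleCat in
theorem ofRep_finDim [Module.Finite k W]
    (g : (V × Bool) ⊕ ((A × Bool) ⊕ (V × Bool)) → Module.End k W)
    (hg : ∀ ⦃x y⦄, Q.sharp.BoundRel k (Q.SharpRel k) x y →
      FreeAlgebra.lift k g x = FreeAlgebra.lift k g y) : Q.isFinDim k (Q.ofRep W g hg) := by
  let φ : W →ₗ[k] Q.ofRep W g hg :=
    { toFun := fun w => w
      map_add' := fun _ _ => rfl
      map_smul' := fun c w => by
        have h : ((RingQuot.liftAlgHom k ⟨FreeAlgebra.lift k g, hg⟩).comp (Q.iAlg k).val)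
            (algebraMap k _ c) = algebraMap k _ c := AlgHom.commutes _ c
        exact (congrArg (fun f : Module.End k W => f w) h).symm }
  exact Module.Finite.of_surjective φ fun w => ⟨w, rfl⟩

end Rep

section Simples

variable [DecidableEq V]

/-- The representation of `Q♯` that is `k` at the vertex `i` and `0` elsewhere. -/
def simpleGen (i : V) : (V × Bool) ⊕ ((A × Bool) ⊕ (V × Bool)) → Module.End k k
  | Sum.inl x => if x = (i, false) then 1 else 0
  | Sum.inr _ => 0

/-- The representation of `Q♯` that is `k` at `i` and at `i'` and `0` elsewhere, in which
`ε_i : k → k` is the identity and the other arrows act by `0`. -/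
def genSimpleGen (i : V) : (V × Bool) ⊕ ((A × Bool) ⊕ (V × Bool)) → Module.End k (k × k)
  | Sum.inl x =>
      if x = (i, false) then LinearMap.inl k k k ∘ₗ LinearMap.fst k k k
      else if x = (i, true) then LinearMap.inr k k k ∘ₗ LinearMap.snd k k k
      else 0
  | Sum.inr (Sum.inl _) => 0
  | Sum.inr (Sum.inr x) =>
      if x = (i, false) then LinearMap.inr k k k ∘ₗ LinearMap.fst k k k else 0

theorem simpleGen_rel (i : V) ⦃x y⦄ (h : Q.sharp.BoundRel k (Q.SharpRel k) x y) :
    FreeAlgebra.lift k (simpleGen (A := A) k i) x = FreeAlgebra.lift k (simpleGen k i) y := by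
  cases h with
  | idem j => simp [FinQuiver.vtx, simpleGen]
  | orth j l h =>
    by_cases h1 : j = (i, false)
    · have h2 : l ≠ (i, false) := fun e => h (h1.trans e.symm)
      simp [FinQuiver.vtx, simpleGen, h2]
    · simp [FinQuiver.vtx, simpleGen, h1]
  | one => simp [FinQuiver.vtx, simpleGen]
  | tgt a => simp [FinQuiver.vtx, FinQuiver.arr, simpleGen]
  | src a => simp [FinQuiver.vtx, FinQuiver.arr, simpleGen]
  | rel x y h =>
    cases h with
    | nil j b => simp [FinQuiver.arr, simpleGen]
    | comm a b => simp [FinQuiver.arr, simpleGen]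

theorem genSimpleGen_rel (i : V) ⦃x y⦄ (h : Q.sharp.BoundRel k (Q.SharpRel k) x y) :
    FreeAlgebra.lift k (genSimpleGen (A := A) k i) x =
      FreeAlgebra.lift k (genSimpleGen k i) y := by
  cases h with
  | idem j =>
    by_cases h1 : j = (i, false)
    · subst h1
      ext <;> simp [FinQuiver.vtx, genSimpleGen]
    · by_cases h2 : j = (i, true)
      · subst h2
        ext <;> simp [FinQuiver.vtx, genSimpleGen]
      · simp [FinQuiver.vtx, genSimpleGen, h1, h2]
  | orth j l h =>
    by_cases h1 : j = (i, false)
    · subst h1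
      by_cases h2 : l = (i, true)
      · subst h2
        ext <;> simp [FinQuiver.vtx, genSimpleGen]
      · simp [FinQuiver.vtx, genSimpleGen, h2, h.symm]
    · by_cases h2 : j = (i, true)
      · subst h2
        by_cases h3 : l = (i, false)
        · subst h3
          ext <;> simp [FinQuiver.vtx, genSimpleGen]
        · simp [FinQuiver.vtx, genSimpleGen, h3, h.symm]
      · simp [FinQuiver.vtx, genSimpleGen, h1, h2]
  | one =>
    have : ∀ x : V × Bool, (genSimpleGen (A := A) k i (Sum.inl x)) =
        (if x = (i, false) then LinearMap.inl k k k ∘ₗ LinearMap.fst k k k else 0) +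
        (if x = (i, true) then LinearMap.inr k k k ∘ₗ LinearMap.snd k k k else 0) := by
      intro x
      by_cases h1 : x = (i, false)
      · subst h1
        simp [genSimpleGen]
      · simp [genSimpleGen, h1]
    simp only [FinQuiver.vtx, map_sum, FreeAlgebra.lift_ι_apply, this, map_one,
      Finset.sum_add_distrib, Finset.sum_ite_eq', Finset.mem_univ, if_true]
    ext <;> simp
  | tgt a =>
    rcases a with a | ⟨j, b⟩
    · simp [FinQuiver.vtx, FinQuiver.arr, genSimpleGen]
    · by_cases h1 : (j, b) = (i, false)
      · obtain ⟨rfl, rfl⟩ := Prod.mk.inj h1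
        rw [sharp_tgt_inr]
        ext <;> simp [FinQuiver.vtx, FinQuiver.arr, genSimpleGen]
      · simp [FinQuiver.vtx, FinQuiver.arr, genSimpleGen, h1]
  | src a =>
    rcases a with a | ⟨j, b⟩
    · simp [FinQuiver.vtx, FinQuiver.arr, genSimpleGen]
    · by_cases h1 : (j, b) = (i, false)
      · obtain ⟨rfl, rfl⟩ := Prod.mk.inj h1
        rw [sharp_src_inr]
        ext <;> simp [FinQuiver.vtx, FinQuiver.arr, genSimpleGen]
      · simp [FinQuiver.vtx, FinQuiver.arr, genSimpleGen, h1]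
  | rel x y h =>
    cases h with
    | nil j b => cases b <;> simp [FinQuiver.arr, genSimpleGen]
    | comm a b => simp [FinQuiver.arr, genSimpleGen]

/-- The one-dimensional simple `Λ^ı`-module `S_i` supported at the vertex `i`. -/
def simple (i : V) : Q.Mod k :=
  ⟨Q.ofRep k (simpleGen k i) (Q.simpleGen_rel k i), Q.ofRep_finDim k _ _⟩

/-- The generalized simple `Λ^ı`-module `𝔼_i`: if `τ i = i`, it is `k[ε_i]/(ε_i²)`, supported at
the vertex `i`, and if `τ i ≠ i`, it is `k` at `i` and at `τ i`, with `ε_i = 1` and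
`ε_{τ i} = 0`. -/
def genSimple (i : V) : Q.Mod k :=
  ⟨Q.ofRep (k × k) (genSimpleGen k i) (Q.genSimpleGen_rel k i), Q.ofRep_finDim (k × k) _ _⟩

end Simples

end IQuiver

/-! ## Twisted semi-derived Ringel-Hall algebras -/

namespace HallAlg

section

attribute [local instance] HasDerivedCategory.standard HasExt.standard

variable (C : Type (u + 1)) [Category.{u} C] [Abelian C]

/-- The set of isomorphism classes of objects. -/
abbrev Iso : Type (u + 1) := Quotient (isIsomorphicSetoid C)

variable {C}

/-- The isomorphism class of an object. -/
abbrev isoCls (M : C) : Iso C := Quotient.mk (isIsomorphicSetoid C) M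

/-- `Ext¹(M, N)_L`: the classes of the short exact sequences `0 → N → E → M → 0` whose middle
term `E` lies in the isomorphism class `L`. -/
def extMid (M N : C) (L : Iso C) : Set (Abelian.Ext.{u + 1} M N 1) :=
  {ξ | ∃ (E : C) (f : N ⟶ E) (g : E ⟶ M) (w : f ≫ g = 0)
    (h : (ShortComplex.mk f g w).ShortExact), isoCls E = L ∧ h.extClass = ξ}

/-- The structure constant `|Ext¹(M, N)_L| / |Hom(M, N)|` of the Ringel-Hall algebra. -/
def hallNum (M N : C) (L : Iso C) : ℚ := Nat.card (extMid M N L) / Nat.card (M ⟶ N)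

variable (C) in
/-- The Grothendieck group `K₀(C)`. -/
def K0 : Type (u + 1) :=
  FreeAbelianGroup C ⧸ AddSubgroup.closure
    {x : FreeAbelianGroup C | ∃ S : ShortComplex C, S.ShortExact ∧
      x = FreeAbelianGroup.of S.X₂ - FreeAbelianGroup.of S.X₁ - FreeAbelianGroup.of S.X₃}

/-- The class of an object in `K₀(C)`. -/
def k0Cls (M : C) : K0 C := QuotientAddGroup.mk (FreeAbelianGroup.of M)

variable (C) in
/-- The embedding of `C` in its bounded derived category. -/
def toBounded : C ⥤ DerivedCategory.Bounded C :=
  DerivedCategory.TStructure.t.bounded.lift (DerivedCategory.singleFunctor C 0)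
    fun _ => ⟨⟨0, inferInstance⟩, ⟨0, inferInstance⟩⟩

variable (C) in
/-- The objects of finite projective dimension, in the bounded derived category. -/
def finProjDim : ObjectProperty (DerivedCategory.Bounded C) :=
  fun X => ∃ M : C, (∃ n : ℕ, HasProjectiveDimensionLE M n) ∧ X = (toBounded C).obj M

variable (C) in
/-- The singularity category `D_sg(C)`: the Verdier quotient of the bounded derived category by
the thick subcategory generated by the objects of finite projective dimension. -/
abbrev Dsg : Type (u + 1) := (finProjDim C).triangEnvelope.trW.Localization

variable (C) in
/-- The functor from `C` to its singularity category. -/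
def toDsg : C ⥤ Dsg C := toBounded C ⋙ (finProjDim C).triangEnvelope.trW.Q

variable (C) in
/-- The generators of the localized Hall algebra: the class `[M]` of each object, and the inverse
`[K]⁻¹` of the class of each object of projective dimension at most one. -/
abbrev Gen : Type (u + 1) := Iso C ⊕ {K : C // HasProjectiveDimensionLE K 1}

variable (F : Type) [Field F]

/-- The generator `[M]`. -/
def gen (L : Iso C) : FreeAlgebra F (Gen C) := FreeAlgebra.ι F (Sum.inl L)

/-- The generator `[K]⁻¹`. -/
def genInv (K : {K : C // HasProjectiveDimensionLE K 1}) : FreeAlgebra F (Gen C) :=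
  FreeAlgebra.ι F (Sum.inr K)

variable [CharZero F] (v : F) (χ : C → C → ℤ)

/-- The defining relations of the twisted semi-derived Ringel-Hall algebra.

* `zero`, `mul`: the twisted Ringel-Hall algebra, which is the algebra with basis the `[M]`, unit
  `[0]` and product `[M] * [N] = v ^ χ(M, N) ∑_L |Ext¹(M, N)_L| / |Hom(M, N)| [L]`;
* `ideal`: the quotient by the two-sided ideal generated by the differences `[M] - [N]`, where `M`
  and `N` have the same class in `K₀(C)` and are isomorphic in `D_sg(C)`;
* `mul_inv`, `inv_mul`: the localization at the classes `[K]` of the objects `K` of projective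
  dimension at most one. -/
inductive Rel : FreeAlgebra F (Gen C) → FreeAlgebra F (Gen C) → Prop
  | zero (Z : C) (h : IsZero Z) : Rel (gen F (isoCls Z)) 1
  | mul (M N : C) : Rel (gen F (isoCls M) * gen F (isoCls N))
      (v ^ χ M N • ∑ᶠ L : Iso C, (hallNum M N L : F) • gen F L)
  | ideal (M N : C) (h₀ : k0Cls M = k0Cls N) (h : Nonempty ((toDsg C).obj M ≅ (toDsg C).obj N)) :
      Rel (gen F (isoCls M)) (gen F (isoCls N))
  | mul_inv (K : {K : C // HasProjectiveDimensionLE K 1}) :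
      Rel (gen F (isoCls K.1) * genInv F K) 1
  | inv_mul (K : {K : C // HasProjectiveDimensionLE K 1}) :
      Rel (genInv F K * gen F (isoCls K.1)) 1

/-- The semi-derived Ringel-Hall algebra of `C` over the field `F`, twisted by `v ^ χ`. -/
abbrev SDHall : Type (u + 1) := RingQuot (Rel (C := C) F v χ)

/-- The element `[M]` of the twisted semi-derived Ringel-Hall algebra. -/
def cls (M : C) : SDHall F v χ := RingQuot.mkAlgHom F (Rel F v χ) (gen F (isoCls M))

end

end HallAlg

namespace IQuiver

/-- The field `ℚ(v)` with `v = √q`. -/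
abbrev QSqrt (q : ℕ) : Type := IntermediateField.adjoin ℚ {√(q : ℝ)}

/-- The element `v = √q` of `ℚ(√q)`. -/
def vEl (q : ℕ) : QSqrt q := IntermediateField.AdjoinSimple.gen ℚ √(q : ℝ)

variable {V A : Type} [Fintype V] [Fintype A] (Q : IQuiver V A) (k : Type u) [Field k]

/-- The iHall algebra of `(Q, τ)` over `k`: the semi-derived Ringel-Hall algebra of `mod(Λ^ı)`
over `ℚ(v)`, `v = √|k|`, with the product twisted by `v ^ ⟨res M, res N⟩_Q`. -/
abbrev IHall : Type (u + 1) :=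
  HallAlg.SDHall (C := Q.Mod k) (QSqrt (Nat.card k)) (vEl (Nat.card k)) (Q.eulerRes k)

/-- The element `[M]` of the iHall algebra. -/
def hcls (M : Q.Mod k) : Q.IHall k := HallAlg.cls _ _ _ M

/-- The iquiver `1 → 2 ← 3` with the involution that swaps `1` and `3`; the vertices `1, 2, 3`
are `0, 1, 2 : Fin 3`, and the arrows are `0 : 1 → 2` and `1 : 3 → 2`. -/
def A3 : IQuiver (Fin 3) (Fin 2) where
  src := ![0, 2]
  tgt := ![1, 1]
  τ := ![2, 1, 0]
  τA := ![1, 0]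
  τ_τ := by decide
  τA_τA := by decide
  src_τA := by decide
  tgt_τA := by decide

end IQuiver

end

/-! Every module in the two identities is supported at one source vertex i and at the vertex 2. On
such a module ε_i and ε_{τ i} act by 0, because each starts or ends at the third vertex. So the
module is a pair of linear maps α : U → W, ε : W → W with εα = 0 and ε² = 0 (`exists_rep`).

An extension of M = (U, W) by N = (U', W') is a block triangular pair. Its off-diagonal blocks form
a finite group of cocycles, and two cocycles have the same class in Ext¹ iff they differ by the
coboundary of an element of C = Hom(U, U') × Hom(W, W') (`Rep.exists_cocycle`, `Rep.extCls_eq_iff`).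
The kernel of the coboundary map is Hom(M, N), so |Ext¹(M, N)_L| / |Hom(M, N)| is the number of
cocycles with middle term L divided by |C| (`Rep.hallNum_eq`): neither Ext¹ nor Hom has to be
determined. With the Euler twist the factor becomes v^{-(uu' + ww' + uw')}, where the exponent is
made of dimensions (`Rep.hcls_mul_hcls`). Between semisimple modules every pair of blocks is a
cocycle, and in the cases needed the class of the middle term depends only on which of the two
blocks vanish (`zcls_mul`).

First identity. Let Z = [S_i² ⊕ S_2] and let A be the class of the modules of dimension (2, 1) with
α ≠ 0. The three products are v^{-3}(Z + (q² - 1)A), v^{-2}(Z + (q - 1)A) and v^{-1}Z, and the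
combination vanishes.

Second identity. Let Z = [S_i ⊕ S_2²], and let A be the class with α ≠ 0, ε = 0. The modules of
dimension (1, 2) with ε ≠ 0 are S_i ⊕ 𝔼₂ and a nonsplit extension of S_i by 𝔼₂. Only the loop leaves
the vertex 2, so 𝔼₂ is projective. The ideal relation therefore identifies the two modules, and
their common class X equals [S_i] * [𝔼₂] (`Rep.hcls_eq_hcls_repε`, `zcls_mul_hcls_repε`). The three
products are v^{-1}(Z + (q - 1)X), v^{-2}(Z + (q - 1)A + q(q - 1)X) and v^{-3}(Z + (q² - 1)A) +
v^{-1}(q - 1)X. Now Z and A cancel, and X is left with (q - 1)(v^{-1} - v) = -(q - 1)²/v. The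
inverses adjoined in the localization are not used.

Since Λ^ı is defined as a fixed subalgebra, its description by quiver and relations has to be
recovered first: `adjoin_range_iGen` gives the generators, and `RepData.lift` builds modules from
elements that satisfy the relations. -/

noncomputable section
-- Equivalence of extensions, K₀ and the singularity category
namespace HallAlg

section

attribute [local instance] HasDerivedCategory.standard HasExt.standard

variable {C : Type (u + 1)} [Category.{u} C] [Abelian C]

/-- An isomorphism of short exact sequences with the same ends preserves the extension class. -/
theorem extClass_eq_of_hom {M N E E' : C} {f : N ⟶ E} {g : E ⟶ M} {w : f ≫ g = 0}
    {f' : N ⟶ E'} {g' : E' ⟶ M} {w' : f' ≫ g' = 0}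
    (h : (ShortComplex.mk f g w).ShortExact) (h' : (ShortComplex.mk f' g' w').ShortExact)
    (φ : E ⟶ E') (hf : f ≫ φ = f') (hg : φ ≫ g' = g) : h.extClass = h'.extClass := by
  have := h.extClass_naturality h'
    { τ₁ := 𝟙 N, τ₂ := φ, τ₃ := 𝟙 M, comm₁₂ := by simp [hf], comm₂₃ := by simp [hg] }
  simpa using this

/-- Short exact sequences with the same extension class are equivalent. -/
theorem exists_hom_of_extClass_eq {M N E E' : C} {f : N ⟶ E} {g : E ⟶ M} {w : f ≫ g = 0}
    {f' : N ⟶ E'} {g' : E' ⟶ M} {w' : f' ≫ g' = 0}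
    (h : (ShortComplex.mk f g w).ShortExact) (h' : (ShortComplex.mk f' g' w').ShortExact)
    (e : h.extClass = h'.extClass) : ∃ φ : E ⟶ E', f ≫ φ = f' ∧ φ ≫ g' = g := by
  -- The pushout of the common class along `f'` is zero, so `f'` extends along `f` to a map E → E'.
  obtain ⟨x, hx⟩ := Abelian.Ext.contravariant_sequence_exact₁ h E' (Abelian.Ext.mk₀ f')
    (add_zero 1) (by rw [e]; exact h'.extClass_comp)
  obtain ⟨φ₀, rfl⟩ := (Abelian.Ext.mk₀_bijective _ _).2 x
  replace hx : f ≫ φ₀ = f' := by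
    apply (Abelian.Ext.mk₀_bijective _ _).1
    rw [← hx, Abelian.Ext.mk₀_comp_mk₀]
  have hz : f ≫ (φ₀ ≫ g') = 0 := by rw [← Category.assoc, hx, w']
  have hepi : Epi g := h.epi_g
  -- The map `φ₀` is right on `N` but induces some `ψ` on `M` in place of the identity. The pullback
  -- of the class along `ψ - 𝟙` is zero, so `ψ - 𝟙` lifts through `g'` to a map `s`, and subtracting
  -- `g ≫ s` repairs `φ₀` without changing it on `N`.
  let ψ : M ⟶ M := h.exact.desc (φ₀ ≫ g') hz
  have hψ : g ≫ ψ = φ₀ ≫ g' := h.exact.g_desc _ _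
  have hn := h.extClass_naturality h'
    { τ₁ := 𝟙 N, τ₂ := φ₀, τ₃ := ψ, comm₁₂ := by simp [hx], comm₂₃ := by simp [hψ] }
  obtain ⟨y, hy⟩ := Abelian.Ext.covariant_sequence_exact₃ M h' (Abelian.Ext.mk₀ (ψ - 𝟙 M))
    (zero_add 1) (by
      rw [sub_eq_add_neg, Abelian.Ext.mk₀_add, Abelian.Ext.add_comp, Abelian.Ext.mk₀_neg,
        Abelian.Ext.neg_comp, Abelian.Ext.mk₀_id_comp]
      have hn' := hn.symm
      dsimp only at hn'
      rw [hn', Abelian.Ext.comp_mk₀_id, e, add_neg_cancel])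
  obtain ⟨s, rfl⟩ := (Abelian.Ext.mk₀_bijective _ _).2 y
  replace hy : s ≫ g' = ψ - 𝟙 M := by
    apply (Abelian.Ext.mk₀_bijective _ _).1
    rw [← hy, Abelian.Ext.mk₀_comp_mk₀]
  refine ⟨φ₀ - g ≫ s, ?_, ?_⟩
  · rw [Preadditive.comp_sub, hx, ← Category.assoc, w, zero_comp, sub_zero]
  · rw [Preadditive.sub_comp, Category.assoc, hy, Preadditive.comp_sub, hψ, Category.comp_id,
      sub_sub_cancel]

theorem k0Cls_of_shortExact {S : ShortComplex C} (hS : S.ShortExact) :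
    (QuotientAddGroup.mk (FreeAbelianGroup.of S.X₂) : K0 C) =
      QuotientAddGroup.mk (FreeAbelianGroup.of S.X₁ + FreeAbelianGroup.of S.X₃) := by
  refine (QuotientAddGroup.eq.2 ?_).symm
  refine AddSubgroup.subset_closure ⟨S, hS, by abel⟩

theorem k0Cls_eq {S S' : ShortComplex C} (hS : S.ShortExact) (hS' : S'.ShortExact)
    (h₁ : S.X₁ = S'.X₁) (h₃ : S.X₃ = S'.X₃) : k0Cls S.X₂ = k0Cls S'.X₂ :=
  (k0Cls_of_shortExact hS).trans (by rw [h₁, h₃]; exact (k0Cls_of_shortExact hS').symm)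

/-- An epimorphism whose kernel has finite projective dimension is invertible in `D_sg`. -/
theorem isIso_toDsg_map {S : ShortComplex C} (hS : S.ShortExact) {n : ℕ}
    (h : HasProjectiveDimensionLE S.X₁ n) : IsIso ((toDsg C).map S.g) := by
  have : (finProjDim C).triangEnvelope.trW ((toBounded C).map S.g) := by
    rw [ObjectProperty.trW_iff']
    refine ⟨(toBounded C).obj S.X₁, (toBounded C).map S.f,
      ObjectProperty.homMk (hS.singleδ ≫
        (DerivedCategory.TStructure.t.bounded.ι.commShiftIso (1 : ℤ)).inv.app
          ((toBounded C).obj S.X₁)), ?_,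
      ObjectProperty.le_triangEnvelope _ _ ⟨S.X₁, ⟨n, h⟩, rfl⟩⟩
    rw [← DerivedCategory.TStructure.t.bounded.ι.map_distinguished_iff]
    refine Pretriangulated.isomorphic_distinguished _ hS.singleTriangle_distinguished _
      (Pretriangulated.Triangle.isoMk _ _ (Iso.refl _) (Iso.refl _) (Iso.refl _) ?_ ?_ ?_)
    · simp; rfl
    · simp; rfl
    -- The inverse of `commShiftIso` put into the connecting morphism cancels the one that appears
    -- when the triangle is mapped to the unbounded derived category.
    · have key : ∀ {D : Type (u + 1)} [Category.{u + 1} D] {X Y Y' : D} (d : X ⟶ Y)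
          (e : Y' ≅ Y) (t : Y ⟶ Y), t = 𝟙 Y → ((d ≫ e.inv) ≫ e.hom) ≫ t = 𝟙 X ≫ d := by
        rintro D _ X Y Y' d e t rfl
        simp
      exact key hS.singleδ ((DerivedCategory.TStructure.t.bounded.ι.commShiftIso (1 : ℤ)).app
        ((toBounded C).obj S.X₁)) _ (CategoryTheory.Functor.map_id _ _)
  exact Localization.inverts (finProjDim C).triangEnvelope.trW.Q _ _ this

/-- Both middle terms become isomorphic to the common quotient once the kernels are killed. Together
with `k0Cls_eq` this supplies the hypotheses of the ideal relation. -/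
theorem dsg_iso {S S' : ShortComplex C} (hS : S.ShortExact) (hS' : S'.ShortExact) {n : ℕ}
    (h : HasProjectiveDimensionLE S.X₁ n) (h' : HasProjectiveDimensionLE S'.X₁ n)
    (h₃ : S.X₃ = S'.X₃) : Nonempty ((toDsg C).obj S.X₂ ≅ (toDsg C).obj S'.X₂) := by
  have := isIso_toDsg_map hS h
  have := isIso_toDsg_map hS' h'
  exact ⟨asIso ((toDsg C).map S.g) ≪≫ eqToIso (by rw [h₃]) ≪≫ (asIso ((toDsg C).map S'.g)).symm⟩

end
end HallAlg
end

noncomputable section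
namespace IQuiver

variable {V A : Type} [Fintype V] (Q : IQuiver V A) (k : Type u) [Field k]

/-! ## Generators of the iquiver algebra -/

/-- The image in `Λ` of a vertex or an arrow of `Q♯`. -/
def lamGen (g : (V × Bool) ⊕ ((A × Bool) ⊕ (V × Bool))) : Q.Lam k :=
  Q.toLam k (FreeAlgebra.ι k g)

theorem tauSharp_lamGen (g : (V × Bool) ⊕ ((A × Bool) ⊕ (V × Bool))) :
    Q.tauSharp k (Q.lamGen k g) = Q.lamGen k (Q.sharpGen g) := by
  simp [lamGen, tauSharp, tauFree]

theorem sharpGen_sharpGen (g : (V × Bool) ⊕ ((A × Bool) ⊕ (V × Bool))) :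
    Q.sharpGen (Q.sharpGen g) = g := by
  rcases g with ⟨i, b⟩ | ⟨a, b⟩ | ⟨i, b⟩ <;> simp [sharpGen, Q.τ_τ, Q.τA_τA]

theorem lam_algHom_ext {B : Type*} [Semiring B] [Algebra k B] {f g : Q.Lam k →ₐ[k] B}
    (h : ∀ x, f (Q.lamGen k x) = g (Q.lamGen k x)) : f = g := by
  apply RingQuot.ringQuot_ext'
  apply FreeAlgebra.hom_ext
  funext x
  exact h x

theorem tauSharp_tauSharp (x : Q.Lam k) : Q.tauSharp k (Q.tauSharp k x) = x := by
  have : (Q.tauSharp k).comp (Q.tauSharp k) = AlgHom.id k _ := by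
    apply Q.lam_algHom_ext
    intro x
    simp [tauSharp_lamGen, sharpGen_sharpGen]
  exact DFunLike.congr_fun this x

theorem mem_iAlg {x : Q.Lam k} : x ∈ Q.iAlg k ↔ Q.tauSharp k x = x := Iff.rfl

/-- The generator of `Λ^ı` attached to a vertex or an arrow of `Q♯`. -/
def iGen (g : (V × Bool) ⊕ ((A × Bool) ⊕ (V × Bool))) : Q.iAlg k :=
  ⟨Q.lamGen k g + Q.lamGen k (Q.sharpGen g), by
    rw [mem_iAlg, map_add, tauSharp_lamGen, tauSharp_lamGen, sharpGen_sharpGen, add_comm]⟩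

theorem coe_iGen (g : (V × Bool) ⊕ ((A × Bool) ⊕ (V × Bool))) :
    (Q.iGen k g : Q.Lam k) = Q.lamGen k g + Q.lamGen k (Q.sharpGen g) := rfl

theorem iGen_sharpGen (g : (V × Bool) ⊕ ((A × Bool) ⊕ (V × Bool))) :
    Q.iGen k (Q.sharpGen g) = Q.iGen k g := by
  apply Subtype.ext
  rw [coe_iGen, coe_iGen, sharpGen_sharpGen, add_comm]

/-- The arrow `a` in `Λ^ı`. -/
def iArr (a : A) : Q.iAlg k := Q.iGen k (Sum.inr (Sum.inl (a, false)))

/-- The arrow `ε_i : i → τ i` in `Λ^ı`. -/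
def iEps (i : V) : Q.iAlg k := Q.iGen k (Sum.inr (Sum.inr (i, false)))

theorem idem_eq_iGen (i : V) : Q.idem k i = Q.iGen k (Sum.inl (i, false)) := rfl

/-- The sum of the trivial paths at one of the two levels of `Q♯`. -/
def lev (b : Bool) : Q.Lam k := ∑ i, Q.lamGen k (Sum.inl (i, b))

/-- The two levels give complementary idempotents of Λ that `tauSharp` exchanges. An invariant
element is therefore determined by its part at one level, which is what `symm_coe` expresses. -/
theorem lev_add_lev : Q.lev k false + Q.lev k true = 1 := by
  have := Q.toLam_rel k .one
  rw [map_one, map_sum, Fintype.sum_prod_type, Finset.sum_congr rfl fun i _ => Fintype.sum_bool _,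
    Finset.sum_add_distrib, add_comm] at this
  exact this

theorem tauSharp_lev (b : Bool) : Q.tauSharp k (Q.lev k b) = Q.lev k (!b) := by
  rw [lev, map_sum]
  refine Fintype.sum_bijective Q.τ (Function.Involutive.bijective Q.τ_τ) _ _ fun i => ?_
  rw [tauSharp_lamGen]
  rfl

theorem lev_mul_vtx (b : Bool) (x : V × Bool) :
    Q.lev k b * Q.lamGen k (Sum.inl x) = if b = x.2 then Q.lamGen k (Sum.inl x) else 0 := by
  classical
  obtain ⟨i, c⟩ := x
  have h : ∀ j, Q.lamGen k (Sum.inl (j, b)) * Q.lamGen k (Sum.inl (i, c)) =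
      if j = i then (if b = c then Q.lamGen k (Sum.inl (i, c)) else 0) else 0 := by
    intro j
    by_cases e : (j, b) = (i, c)
    · obtain ⟨rfl, rfl⟩ := Prod.mk.inj e
      simpa [lamGen, FinQuiver.vtx] using Q.toLam_rel k (.idem (j, b))
    · have h0 := Q.toLam_rel k (.orth _ _ e)
      have : (if j = i then (if b = c then Q.lamGen k (Sum.inl (i, c)) else 0) else 0) = 0 := by
        split_ifs with h1 h2
        · exact absurd (Prod.ext h1 h2) e
        · rfl
        · rfl
      rw [this]
      simpa [lamGen, FinQuiver.vtx] using h0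
  simp [lev, Finset.sum_mul, h]

theorem vtx_mul_lev (b : Bool) (x : V × Bool) :
    Q.lamGen k (Sum.inl x) * Q.lev k b = if b = x.2 then Q.lamGen k (Sum.inl x) else 0 := by
  classical
  obtain ⟨i, c⟩ := x
  have h : ∀ j, Q.lamGen k (Sum.inl (i, c)) * Q.lamGen k (Sum.inl (j, b)) =
      if j = i then (if b = c then Q.lamGen k (Sum.inl (i, c)) else 0) else 0 := by
    intro j
    by_cases e : (j, b) = (i, c)
    · obtain ⟨rfl, rfl⟩ := Prod.mk.inj e
      simpa [lamGen, FinQuiver.vtx] using Q.toLam_rel k (.idem (j, b))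
    · have h0 := Q.toLam_rel k (.orth _ _ (Ne.symm e))
      have : (if j = i then (if b = c then Q.lamGen k (Sum.inl (i, c)) else 0) else 0) = 0 := by
        split_ifs with h1 h2
        · exact absurd (Prod.ext h1 h2) e
        · rfl
        · rfl
      rw [this]
      simpa [lamGen, FinQuiver.vtx] using h0
  simp [lev, Finset.mul_sum, h]

/-- The level of the target of a generator. -/
def tgtLev : (V × Bool) ⊕ ((A × Bool) ⊕ (V × Bool)) → Bool
  | Sum.inl x => x.2
  | Sum.inr (Sum.inl x) => x.2
  | Sum.inr (Sum.inr x) => !x.2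

/-- The level of the source of a generator. -/
def srcLev : (V × Bool) ⊕ ((A × Bool) ⊕ (V × Bool)) → Bool
  | Sum.inl x => x.2
  | Sum.inr (Sum.inl x) => x.2
  | Sum.inr (Sum.inr x) => x.2

theorem lev_mul_lamGen (b : Bool) (g : (V × Bool) ⊕ ((A × Bool) ⊕ (V × Bool))) :
    Q.lev k b * Q.lamGen k g = if b = tgtLev g then Q.lamGen k g else 0 := by
  rcases g with x | a
  · exact Q.lev_mul_vtx k b x
  · have h := Q.toLam_rel k (.tgt a)
    replace h : Q.lamGen k (Sum.inl (Q.sharp.tgt a)) * Q.lamGen k (Sum.inr a) =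
      Q.lamGen k (Sum.inr a) := by simpa [lamGen, FinQuiver.vtx, FinQuiver.arr] using h
    have h' : tgtLev (Sum.inr a) = (Q.sharp.tgt a).2 := by rcases a with a | i <;> rfl
    rw [← h, ← mul_assoc, lev_mul_vtx, h']
    split_ifs <;> simp

theorem lamGen_mul_lev (b : Bool) (g : (V × Bool) ⊕ ((A × Bool) ⊕ (V × Bool))) :
    Q.lamGen k g * Q.lev k b = if b = srcLev g then Q.lamGen k g else 0 := by
  rcases g with x | a
  · exact Q.vtx_mul_lev k b x
  · have h := Q.toLam_rel k (.src a)
    replace h : Q.lamGen k (Sum.inr a) * Q.lamGen k (Sum.inl (Q.sharp.src a)) =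
      Q.lamGen k (Sum.inr a) := by simpa [lamGen, FinQuiver.vtx, FinQuiver.arr] using h
    have h' : srcLev (Sum.inr a) = (Q.sharp.src a).2 := by rcases a with a | i <;> rfl
    rw [← h, mul_assoc, vtx_mul_lev, h']
    split_ifs <;> simp

/-- The symmetrization of the part of `x` that ends at the level `b`. -/
def symm (b : Bool) (x : Q.Lam k) : Q.iAlg k :=
  ⟨Q.lev k b * x + Q.tauSharp k (Q.lev k b * x), by
    rw [mem_iAlg, map_add, tauSharp_tauSharp, add_comm]⟩

theorem coe_symm (b : Bool) (x : Q.Lam k) :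
    (Q.symm k b x : Q.Lam k) = Q.lev k b * x + Q.lev k (!b) * Q.tauSharp k x := by
  change Q.lev k b * x + Q.tauSharp k (Q.lev k b * x) = _
  rw [map_mul, tauSharp_lev]

theorem symm_coe (x : Q.iAlg k) : Q.symm k false x = x := by
  apply Subtype.ext
  rw [coe_symm, (Q.mem_iAlg k).1 x.2, ← add_mul]
  exact (congrArg (· * (x : Q.Lam k)) (Q.lev_add_lev k)).trans (one_mul _)

/-- In the product on the right the cross terms pair a generator with the wrong level and vanish.
This peels the leftmost letter off a word in Λ and replaces it by a generator of the fixed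
subalgebra. -/
theorem symm_lamGen_mul (g : (V × Bool) ⊕ ((A × Bool) ⊕ (V × Bool))) (x : Q.Lam k) :
    Q.symm k (tgtLev g) (Q.lamGen k g * x) = Q.iGen k g * Q.symm k (srcLev g) x := by
  have ht : tgtLev (Q.sharpGen g) = !tgtLev g := by
    rcases g with ⟨i, b⟩ | ⟨a, b⟩ | ⟨i, b⟩ <;> rfl
  have hs : srcLev (Q.sharpGen g) = !srcLev g := by
    rcases g with ⟨i, b⟩ | ⟨a, b⟩ | ⟨i, b⟩ <;> rfl
  apply Subtype.ext
  rw [MulMemClass.coe_mul, coe_symm, coe_symm, coe_iGen, map_mul, tauSharp_lamGen, ← mul_assoc,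
    ← mul_assoc, lev_mul_lamGen, lev_mul_lamGen, ht, add_mul, mul_add, mul_add, ← mul_assoc,
    ← mul_assoc, ← mul_assoc, ← mul_assoc, lamGen_mul_lev, lamGen_mul_lev, lamGen_mul_lev,
    lamGen_mul_lev, hs]
  simp

theorem symm_lamGen_mul_of_ne {b : Bool} (g : (V × Bool) ⊕ ((A × Bool) ⊕ (V × Bool)))
    (h : b ≠ tgtLev g) (x : Q.Lam k) : Q.symm k b (Q.lamGen k g * x) = 0 := by
  have ht : tgtLev (Q.sharpGen g) = !tgtLev g := by
    rcases g with ⟨i, b⟩ | ⟨a, b⟩ | ⟨i, b⟩ <;> rfl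
  apply Subtype.ext
  rw [coe_symm, map_mul, tauSharp_lamGen, ← mul_assoc,
    ← mul_assoc, lev_mul_lamGen, lev_mul_lamGen, ht, if_neg h, if_neg (by simpa using h)]
  simp

theorem symm_add (b : Bool) (x y : Q.Lam k) :
    Q.symm k b (x + y) = Q.symm k b x + Q.symm k b y := by
  apply Subtype.ext
  rw [AddMemClass.coe_add, coe_symm, coe_symm, coe_symm, map_add, mul_add, mul_add]
  abel

theorem symm_one (b : Bool) : Q.symm k b 1 = 1 := by
  apply Subtype.ext
  rw [coe_symm, map_one, mul_one, mul_one]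
  cases b
  · exact Q.lev_add_lev k
  · exact (add_comm _ _).trans (Q.lev_add_lev k)

theorem symm_algebraMap_mul (b : Bool) (r : k) (x : Q.Lam k) :
    Q.symm k b (algebraMap k _ r * x) = algebraMap k _ r * Q.symm k b x := by
  apply Subtype.ext
  rw [MulMemClass.coe_mul, coe_symm, coe_symm, map_mul, AlgHom.commutes, Subalgebra.coe_algebraMap,
    mul_add, ← mul_assoc, ← mul_assoc, ← mul_assoc, ← mul_assoc, Algebra.commutes, Algebra.commutes]

/-- An element of Λ^ı is the symmetrization of its own lower level part, so it suffices to
symmetrize words in the generators of Λ. Each letter of a word contributes a factor `iGen` or makes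
the result zero. -/
theorem adjoin_range_iGen : Algebra.adjoin k (Set.range (Q.iGen k)) = ⊤ := by
  let P : Q.Lam k → Prop := fun x => ∀ b, Q.symm k b x ∈ Algebra.adjoin k (Set.range (Q.iGen k))
  -- The statement carries a right factor `x` because symmetrization is not multiplicative: only a
  -- leading generator can be pulled out, and the level of the remaining factor changes with it.
  have key : ∀ (y : Q.sharp.Free k) (x : Q.Lam k), P x → P (Q.toLam k y * x) := by
    intro y
    induction y using FreeAlgebra.induction with
    | grade0 r =>
      intro x hx b
      rw [AlgHom.commutes, symm_algebraMap_mul]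
      exact mul_mem (Subalgebra.algebraMap_mem _ r) (hx b)
    | grade1 g =>
      intro x hx b
      by_cases h : b = tgtLev g
      · subst h
        exact (Q.symm_lamGen_mul k g x).symm ▸
          mul_mem (Algebra.subset_adjoin ⟨g, rfl⟩) (hx _)
      · exact (Q.symm_lamGen_mul_of_ne k g h x).symm ▸ zero_mem _
    | mul y z hy hz =>
      intro x hx
      rw [map_mul, mul_assoc]
      exact hy _ (hz _ hx)
    | add y z hy hz =>
      intro x hx b
      rw [map_add, add_mul, symm_add]
      exact add_mem (hy _ hx b) (hz _ hx b)
  rw [eq_top_iff]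
  rintro x -
  obtain ⟨y, hy⟩ := RingQuot.mkAlgHom_surjective k _ (x : Q.Lam k)
  have := key y 1 (fun b => by rw [symm_one]; exact one_mem _) false
  rw [mul_one, toLam, hy, symm_coe] at this
  exact this

theorem iGen_cases {P : Q.iAlg k → Prop} (hv : ∀ i, P (Q.idem k i)) (ha : ∀ a, P (Q.iArr k a))
    (he : ∀ i, P (Q.iEps k i)) (g : (V × Bool) ⊕ ((A × Bool) ⊕ (V × Bool))) :
    P (Q.iGen k g) := by
  rcases g with ⟨i, b⟩ | ⟨a, b⟩ | ⟨i, b⟩ <;> cases b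
  · exact hv i
  · rw [← iGen_sharpGen]; exact hv _
  · exact ha a
  · rw [← iGen_sharpGen]; exact ha _
  · exact he i
  · rw [← iGen_sharpGen]; exact he _

/-- A property of the elements of `Λ^ı` holds if it holds for the generators and is stable under
the operations. -/
theorem iAlg_induction {P : Q.iAlg k → Prop} (hv : ∀ i, P (Q.idem k i))
    (ha : ∀ a, P (Q.iArr k a)) (he : ∀ i, P (Q.iEps k i)) (hr : ∀ r, P (algebraMap k _ r))
    (hadd : ∀ x y, P x → P y → P (x + y)) (hmul : ∀ x y, P x → P y → P (x * y))
    (x : Q.iAlg k) : P x := by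
  have hx : x ∈ Algebra.adjoin k (Set.range (Q.iGen k)) := by
    rw [adjoin_range_iGen]; trivial
  induction hx using Algebra.adjoin_induction with
  | mem x hx => obtain ⟨g, rfl⟩ := hx; exact Q.iGen_cases k hv ha he g
  | algebraMap r => exact hr r
  | add x y _ _ hx hy => exact hadd x y hx hy
  | mul x y _ _ hx hy => exact hmul x y hx hy

end IQuiver
end

noncomputable section
namespace IQuiver

variable {V A : Type} [Fintype V] (Q : IQuiver V A) (k : Type u) [Field k]

/-! ## The presentation of the iquiver algebra -/

/-- Elements of an algebra `B` that satisfy the defining relations of `Λ^ı`. -/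
structure RepData (B : Type*) [Ring B] where
  vtx : V → B
  arr : A → B
  eps : V → B
  idem : ∀ i, vtx i * vtx i = vtx i
  orth : ∀ i j, i ≠ j → vtx i * vtx j = 0
  one : ∑ i, vtx i = 1
  tgt_arr : ∀ a, vtx (Q.tgt a) * arr a = arr a
  arr_src : ∀ a, arr a * vtx (Q.src a) = arr a
  tgt_eps : ∀ i, vtx (Q.τ i) * eps i = eps i
  eps_src : ∀ i, eps i * vtx i = eps i
  nil : ∀ i, eps (Q.τ i) * eps i = 0
  comm : ∀ a, eps (Q.tgt a) * arr a = arr (Q.τA a) * eps (Q.src a)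

namespace RepData

variable {Q k} {B : Type*} [Ring B] [Algebra k B] (D : Q.RepData B)

/-- The action of the generators of `Λ` on the pull-up of a representation of `Λ^ı`. -/
def matGen : (V × Bool) ⊕ ((A × Bool) ⊕ (V × Bool)) → Matrix Bool Bool B
  | Sum.inl (i, false) => Matrix.single false false (D.vtx i)
  | Sum.inl (i, true) => Matrix.single true true (D.vtx (Q.τ i))
  | Sum.inr (Sum.inl (a, false)) => Matrix.single false false (D.arr a)
  | Sum.inr (Sum.inl (a, true)) => Matrix.single true true (D.arr (Q.τA a))
  | Sum.inr (Sum.inr (i, false)) => Matrix.single true false (D.eps i)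
  | Sum.inr (Sum.inr (i, true)) => Matrix.single false true (D.eps (Q.τ i))

/-- The level `false` carries the given representation and the level `true` its twist by τ. Each
relation of Λ at the level `true` is the corresponding relation of `D` at the τ-image of the vertex
or arrow. -/
theorem matGen_rel ⦃x y⦄ (h : Q.sharp.BoundRel k (Q.SharpRel k) x y) :
    FreeAlgebra.lift k D.matGen x = FreeAlgebra.lift k D.matGen y := by
  cases h with
  | idem i => rcases i with ⟨i, _ | _⟩ <;> simp [FinQuiver.vtx, matGen, D.idem]
  | orth i j h =>
    rcases i with ⟨i, _ | _⟩ <;> rcases j with ⟨j, _ | _⟩ <;>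
      simp only [FinQuiver.vtx, map_mul, FreeAlgebra.lift_ι_apply, matGen, map_zero, ne_eq,
        not_false_eq_true, Matrix.single_mul_single_same, Matrix.single_mul_single_of_ne,
        reduceCtorEq]
    · rw [D.orth _ _ (fun e => h (by rw [e])), Matrix.single_zero]
    · rw [D.orth _ _ (fun e => h (by rw [← Q.τ_τ i, e, Q.τ_τ])), Matrix.single_zero]
  | one =>
    have h1 : ∀ b : Bool, ∑ i, Matrix.single b b (D.vtx i) = Matrix.single b b (1 : B) := by
      intro b
      rw [← D.one]
      exact (map_sum (Matrix.singleAddMonoidHom (α := B) b b) _ _).symm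
    have h2 : ∑ i, Matrix.single true true (D.vtx (Q.τ i)) =
        ∑ i, Matrix.single true true (D.vtx i) :=
      Fintype.sum_bijective Q.τ (Function.Involutive.bijective Q.τ_τ) _ _ fun _ => rfl
    rw [map_sum, Fintype.sum_prod_type]
    simp only [FinQuiver.vtx, FreeAlgebra.lift_ι_apply, map_one,
      Fintype.sum_bool, Finset.sum_add_distrib, matGen]
    rw [h2, h1, h1]
    ext b c
    cases b <;> cases c <;> simp [Matrix.single_apply, Matrix.one_apply]
  | tgt a =>
    rcases a with ⟨a, _ | _⟩ | ⟨i, _ | _⟩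
    · simp [FinQuiver.vtx, FinQuiver.arr, matGen, sharp, D.tgt_arr]
    · simp [FinQuiver.vtx, FinQuiver.arr, matGen, sharp, ← Q.tgt_τA, D.tgt_arr]
    · simp [FinQuiver.vtx, FinQuiver.arr, matGen, sharp, D.tgt_eps]
    · have := D.tgt_eps (Q.τ i)
      rw [Q.τ_τ] at this
      simp [FinQuiver.vtx, FinQuiver.arr, matGen, sharp, this]
  | src a =>
    rcases a with ⟨a, _ | _⟩ | ⟨i, _ | _⟩
    · simp [FinQuiver.vtx, FinQuiver.arr, matGen, sharp, D.arr_src]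
    · simp [FinQuiver.vtx, FinQuiver.arr, matGen, sharp, ← Q.src_τA, D.arr_src]
    · simp [FinQuiver.vtx, FinQuiver.arr, matGen, sharp, D.eps_src]
    · simp [FinQuiver.vtx, FinQuiver.arr, matGen, sharp, D.eps_src]
  | rel x y h =>
    cases h with
    | nil i b =>
      have := D.nil (Q.τ i)
      rw [Q.τ_τ] at this
      cases b <;> simp [FinQuiver.arr, matGen, D.nil, this]
    | comm a b =>
      cases b
      · simp [FinQuiver.arr, matGen, D.comm]
      · have := D.comm (Q.τA a)
        rw [Q.tgt_τA, Q.src_τA, Q.τA_τA] at this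
        simp [FinQuiver.arr, matGen, this]

/-- The action of `Λ` on the pull-up of a representation of `Λ^ı`. -/
def matHom : Q.Lam k →ₐ[k] Matrix Bool Bool B :=
  RingQuot.liftAlgHom k ⟨FreeAlgebra.lift k D.matGen, D.matGen_rel⟩

theorem matHom_lamGen (g : (V × Bool) ⊕ ((A × Bool) ⊕ (V × Bool))) :
    D.matHom (Q.lamGen k g) = D.matGen g := by
  simp [matHom, lamGen]

theorem matHom_tauSharp (x : Q.Lam k) (b c : Bool) :
    D.matHom (Q.tauSharp k x) b c = D.matHom x (!b) (!c) := by
  have : D.matHom.comp (Q.tauSharp k) =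
      ((Matrix.reindexAlgEquiv k B Equiv.boolNot).toAlgHom).comp D.matHom := by
    apply Q.lam_algHom_ext
    intro g
    ext b c
    simp only [AlgHom.comp_apply, tauSharp_lamGen, matHom_lamGen]
    rcases g with ⟨i, _ | _⟩ | ⟨a, _ | _⟩ | ⟨i, _ | _⟩ <;> cases b <;> cases c <;>
      simp [sharpGen, matGen, Q.τ_τ, Q.τA_τA]
  have h := congrArg (fun M => M b c) (DFunLike.congr_fun this x)
  simpa using h

/-- An invariant element acts by a circulant 2 × 2 matrix. The sum of the entries of a row is
multiplicative on such matrices, which makes `lift` a homomorphism. -/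
theorem matHom_coe (x : Q.iAlg k) (b c : Bool) :
    D.matHom (x : Q.Lam k) (!b) (!c) = D.matHom (x : Q.Lam k) b c := by
  rw [← matHom_tauSharp, (Q.mem_iAlg k).1 x.2]

/-- The homomorphism from `Λ^ı` given by elements that satisfy the defining relations. -/
def lift : Q.iAlg k →ₐ[k] B where
  toFun x := D.matHom (x : Q.Lam k) false false + D.matHom (x : Q.Lam k) false true
  map_one' := by simp
  map_zero' := by simp
  map_add' x y := by simp only [AddMemClass.coe_add, map_add, Matrix.add_apply]; abel
  map_mul' x y := by
    have h1 := D.matHom_coe y false false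
    have h2 := D.matHom_coe y false true
    simp only [Bool.not_false, Bool.not_true] at h1 h2
    simp only [MulMemClass.coe_mul, map_mul, Matrix.mul_apply, Fintype.sum_bool, h1, h2]
    noncomm_ring
  commutes' r := by
    rw [Subalgebra.coe_algebraMap, AlgHom.commutes]
    simp [Matrix.algebraMap_matrix_apply]

theorem lift_iGen (g : (V × Bool) ⊕ ((A × Bool) ⊕ (V × Bool))) :
    D.lift (Q.iGen k g) = (D.matGen g + D.matGen (Q.sharpGen g)) false false +
      (D.matGen g + D.matGen (Q.sharpGen g)) false true := by
  change D.matHom _ false false + D.matHom _ false true = _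
  rw [coe_iGen, map_add, matHom_lamGen, matHom_lamGen]

theorem lift_idem (i : V) : D.lift (Q.idem k i) = D.vtx i := by
  rw [idem_eq_iGen, lift_iGen]
  simp [matGen, sharpGen]

theorem lift_iArr (a : A) : D.lift (Q.iArr k a) = D.arr a := by
  rw [iArr, lift_iGen]
  simp [matGen, sharpGen]

theorem lift_iEps (i : V) : D.lift (Q.iEps k i) = D.eps i := by
  rw [iEps, lift_iGen]
  simp [matGen, sharpGen, Q.τ_τ]

end RepData

theorem iGen_eq_symm (g : (V × Bool) ⊕ ((A × Bool) ⊕ (V × Bool))) :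
    Q.iGen k g = Q.symm k (tgtLev g) (Q.lamGen k g) := by
  rw [← mul_one (Q.lamGen k g), symm_lamGen_mul, symm_one, mul_one]

/-- When the levels match, a product in Λ^ı is the symmetrization of a product in Λ, so the defining
relations of Λ pass to Λ^ı. -/
theorem iGen_mul_iGen (g h : (V × Bool) ⊕ ((A × Bool) ⊕ (V × Bool)))
    (e : srcLev g = tgtLev h) :
    Q.iGen k g * Q.iGen k h = Q.symm k (tgtLev g) (Q.lamGen k g * Q.lamGen k h) := by
  rw [symm_lamGen_mul, e, ← iGen_eq_symm]

/-- The generators of `Λ^ı` satisfy the defining relations. -/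
def iAlgData : Q.RepData (Q.iAlg k) where
  vtx := Q.idem k
  arr := Q.iArr k
  eps := Q.iEps k
  idem i := by
    rw [idem_eq_iGen, iGen_mul_iGen _ _ _ _ rfl, iGen_eq_symm]
    congr 1
    simpa [lamGen, FinQuiver.vtx] using Q.toLam_rel k (.idem (i, false))
  orth i j h := by
    have := Q.toLam_rel k (.orth (i, false) (j, false) (fun e => h (Prod.mk.inj e).1))
    rw [map_mul, map_zero] at this
    rw [idem_eq_iGen, idem_eq_iGen, iGen_mul_iGen _ _ _ _ rfl]
    exact (congrArg _ this).trans (Subtype.ext (by simp [coe_symm]))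
  one := by
    apply Subtype.ext
    rw [AddSubmonoidClass.coe_finsetSum]
    simp only [idem_eq_iGen, coe_iGen, Finset.sum_add_distrib]
    have h := Q.tauSharp_lev k false
    simp only [lev, map_sum, tauSharp_lamGen] at h
    rw [h]
    exact Q.lev_add_lev k
  tgt_arr a := by
    rw [idem_eq_iGen, iArr, iGen_mul_iGen _ _ _ _ rfl, iGen_eq_symm]
    congr 1
    simpa [lamGen, FinQuiver.vtx, FinQuiver.arr, sharp] using Q.toLam_rel k (.tgt (Sum.inl (a, false)))
  arr_src a := by
    rw [idem_eq_iGen, iArr, iGen_mul_iGen _ _ _ _ rfl, iGen_eq_symm]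
    congr 1
    simpa [lamGen, FinQuiver.vtx, FinQuiver.arr, sharp] using Q.toLam_rel k (.src (Sum.inl (a, false)))
  tgt_eps i := by
    have h : Q.idem k (Q.τ i) = Q.iGen k (Sum.inl (i, true)) := Q.iGen_sharpGen k (Sum.inl (i, true))
    rw [h, iEps, iGen_mul_iGen _ _ _ _ rfl, iGen_eq_symm]
    congr 1
    simpa [lamGen, FinQuiver.vtx, FinQuiver.arr, sharp] using Q.toLam_rel k (.tgt (Sum.inr (i, false)))
  eps_src i := by
    rw [idem_eq_iGen, iEps, iGen_mul_iGen _ _ _ _ rfl, iGen_eq_symm]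
    congr 1
    simpa [lamGen, FinQuiver.vtx, FinQuiver.arr, sharp] using Q.toLam_rel k (.src (Sum.inr (i, false)))
  nil i := by
    -- The representative of ε_{τ i} is changed to ε'_i, whose source lies at the level where ε_i
    -- ends.
    have h : Q.iEps k (Q.τ i) = Q.iGen k (Sum.inr (Sum.inr (i, true))) :=
      Q.iGen_sharpGen k (Sum.inr (Sum.inr (i, true)))
    have := Q.toLam_rel k (.rel _ _ (.nil i false))
    rw [map_mul, map_zero] at this
    rw [h, iEps, iGen_mul_iGen _ _ _ _ rfl]
    exact (congrArg _ this).trans (Subtype.ext (by simp [coe_symm]))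
  comm a := by
    have h : Q.iArr k (Q.τA a) = Q.iGen k (Sum.inr (Sum.inl (a, true))) :=
      Q.iGen_sharpGen k (Sum.inr (Sum.inl (a, true)))
    have := Q.toLam_rel k (.rel _ _ (.comm a false))
    rw [map_mul, map_mul] at this
    rw [h, iEps, iEps, iArr, iGen_mul_iGen _ _ _ _ rfl, iGen_mul_iGen _ _ _ _ rfl]
    exact congrArg _ this

theorem idem_mul_idem_of_ne {i j : V} (h : i ≠ j) : Q.idem k i * Q.idem k j = 0 :=
  (Q.iAlgData k).orth i j h

theorem idem_mul_idem (i : V) : Q.idem k i * Q.idem k i = Q.idem k i := (Q.iAlgData k).idem i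

theorem idem_mul_iArr (a : A) : Q.idem k (Q.tgt a) * Q.iArr k a = Q.iArr k a :=
  (Q.iAlgData k).tgt_arr a

theorem iArr_mul_idem (a : A) : Q.iArr k a * Q.idem k (Q.src a) = Q.iArr k a :=
  (Q.iAlgData k).arr_src a

theorem idem_mul_iEps (i : V) : Q.idem k (Q.τ i) * Q.iEps k i = Q.iEps k i :=
  (Q.iAlgData k).tgt_eps i

theorem iEps_mul_idem (i : V) : Q.iEps k i * Q.idem k i = Q.iEps k i := (Q.iAlgData k).eps_src i

theorem iEps_mul_iEps (i : V) : Q.iEps k (Q.τ i) * Q.iEps k i = 0 := (Q.iAlgData k).nil i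

theorem iEps_mul_iArr (a : A) :
    Q.iEps k (Q.tgt a) * Q.iArr k a = Q.iArr k (Q.τA a) * Q.iEps k (Q.src a) :=
  (Q.iAlgData k).comm a

end IQuiver
end

noncomputable section
namespace IQuiver

section

open scoped ModuleCat

variable {V A : Type} [Fintype V] {Q : IQuiver V A} {k : Type u} [Field k]

/-! ## Morphisms and short exact sequences of finite-dimensional modules -/

/-- This is where the generation of Λ^ı by idempotents, arrows and the ε_i is used: linearity need
only be tested on them. -/
theorem map_smul_of_gens {X Y : Type*} [AddCommGroup X] [AddCommGroup Y] [Module (Q.iAlg k) X]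
    [Module (Q.iAlg k) Y] [Module k X] [Module k Y] [IsScalarTower k (Q.iAlg k) X]
    [IsScalarTower k (Q.iAlg k) Y] (φ : X →ₗ[k] Y)
    (hv : ∀ i x, φ (Q.idem k i • x) = Q.idem k i • φ x)
    (ha : ∀ a x, φ (Q.iArr k a • x) = Q.iArr k a • φ x)
    (he : ∀ i x, φ (Q.iEps k i • x) = Q.iEps k i • φ x) (r : Q.iAlg k) (x : X) :
    φ (r • x) = r • φ x := by
  induction r using Q.iAlg_induction k generalizing x with
  | hv i => exact hv i x
  | ha a => exact ha a x
  | he i => exact he i x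
  | hr r => rw [algebraMap_smul, algebraMap_smul, map_smul]
  | hadd r s hr hs => rw [add_smul, map_add, hr, hs, add_smul]
  | hmul r s hr hs => rw [mul_smul, hr, hs, mul_smul]

/-- A `k`-linear map that commutes with the generators of `Λ^ı`, as a morphism. -/
def homOf {E F : Q.Mod k} (φ : E.obj →ₗ[k] F.obj)
    (hv : ∀ i x, φ (Q.idem k i • x) = Q.idem k i • φ x)
    (ha : ∀ a x, φ (Q.iArr k a • x) = Q.iArr k a • φ x)
    (he : ∀ i x, φ (Q.iEps k i • x) = Q.iEps k i • φ x) : E ⟶ F :=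
  ObjectProperty.homMk (ModuleCat.ofHom
    { toFun := φ, map_add' := map_add φ, map_smul' := map_smul_of_gens φ hv ha he })

/-- The linear map that underlies a morphism. -/
def linOf {E F : Q.Mod k} (f : E ⟶ F) : E.obj →ₗ[k] F.obj := f.hom.hom.restrictScalars k

theorem linOf_smul {E F : Q.Mod k} (f : E ⟶ F) (r : Q.iAlg k) (x : E.obj) :
    linOf f (r • x) = r • linOf f x := f.hom.hom.map_smul r x

theorem linOf_comp {E F G : Q.Mod k} (f : E ⟶ F) (g : F ⟶ G) :
    linOf (f ≫ g) = linOf g ∘ₗ linOf f := rfl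

theorem linOf_injective {E F : Q.Mod k} {f g : E ⟶ F} (h : linOf f = linOf g) : f = g := by
  apply ObjectProperty.hom_ext
  apply ModuleCat.hom_ext
  ext x
  exact DFunLike.congr_fun h x

theorem isIso_of_bijective {E F : Q.Mod k} (f : E ⟶ F) (h : Function.Bijective (linOf f)) :
    IsIso f := by
  have : IsIso ((Q.isFinDim k).ι.map f) := (ConcreteCategory.isIso_iff_bijective f.hom).2 h
  exact isIso_of_reflects_iso f (Q.isFinDim k).ι

instance : PreservesFiniteLimits (Q.isFinDim k).ι :=
  have := fun {X Y : Q.Mod k} (f : X ⟶ Y) => (Q.isFinDim k).preservesKernels_ι f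
  Functor.preservesFiniteLimits_of_preservesKernels _

instance : PreservesFiniteColimits (Q.isFinDim k).ι :=
  have := fun {X Y : Q.Mod k} (f : X ⟶ Y) => (Q.isFinDim k).preservesCokernels_ι f
  Functor.preservesFiniteColimits_of_preservesCokernels _

theorem linOf_surjective {E F : Q.Mod k} (f : E ⟶ F) [Epi f] : Function.Surjective (linOf f) :=
  (ModuleCat.epi_iff_surjective ((Q.isFinDim k).ι.map f)).1 inferInstance

theorem linOf_shortExact {S : ShortComplex (Q.Mod k)} (hS : S.ShortExact) :
    Function.Injective (linOf S.f) ∧ Function.Exact (linOf S.f) (linOf S.g) ∧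
      Function.Surjective (linOf S.g) := by
  have h := hS.map_of_exact (Q.isFinDim k).ι
  exact ⟨(ModuleCat.mono_iff_injective (S.map (Q.isFinDim k).ι).f).1 h.mono_f,
    (ShortComplex.ShortExact.moduleCat_exact_iff_function_exact _).1 h.exact,
    (ModuleCat.epi_iff_surjective (S.map (Q.isFinDim k).ι).g).1 h.epi_g⟩

theorem shortExact_of_linOf {S : ShortComplex (Q.Mod k)} (h₁ : Function.Injective (linOf S.f))
    (h₂ : Function.Exact (linOf S.f) (linOf S.g)) (h₃ : Function.Surjective (linOf S.g)) :
    S.ShortExact where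
  exact := (ShortComplex.exact_map_iff_of_faithful S (Q.isFinDim k).ι).1
    ((ShortComplex.ShortExact.moduleCat_exact_iff_function_exact _).2 h₂)
  mono_f := (Q.isFinDim k).ι.mono_of_mono_map ((ModuleCat.mono_iff_injective ((Q.isFinDim k).ι.map S.f)).2 h₁)
  epi_g := (Q.isFinDim k).ι.epi_of_epi_map ((ModuleCat.epi_iff_surjective ((Q.isFinDim k).ι.map S.g)).2 h₃)

theorem hcls_congr [Fintype A] {E F : Q.Mod k} (e : E ≅ F) : Q.hcls k E = Q.hcls k F := by
  have : HallAlg.isoCls E = HallAlg.isoCls F := Quotient.sound ⟨e⟩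
  simp only [hcls, HallAlg.cls, this]

end

/-! ## Representations of `i → 2` with a nilpotent loop at `2` -/

variable {k : Type u} [Field k]

/-- A representation of the quiver `α : 1 → 2` with a loop `ε` at `2`, with the
relations `εα = 0` and `ε² = 0`. -/
structure Rep (k U W : Type*) [Field k] [AddCommGroup U] [Module k U] [AddCommGroup W]
    [Module k W] where
  α : U →ₗ[k] W
  ε : W →ₗ[k] W
  ε_α : ∀ u, ε (α u) = 0
  ε_ε : ∀ w, ε (ε w) = 0

section

variable {U W : Type u} [AddCommGroup U] [Module k U] [AddCommGroup W] [Module k W]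

/-- The action of the generators of `Λ^ı` on a representation that is supported at the source of
the arrow `a` and at the vertex `2`. -/
def Rep.data (a : Fin 2) (R : Rep k U W) : A3.RepData (Module.End k (U × W)) where
  vtx j := if j = A3.src a then LinearMap.inl k U W ∘ₗ LinearMap.fst k U W
    else if j = 1 then LinearMap.inr k U W ∘ₗ LinearMap.snd k U W else 0
  arr b := if b = a then LinearMap.inr k U W ∘ₗ R.α ∘ₗ LinearMap.fst k U W else 0
  eps j := if j = 1 then LinearMap.inr k U W ∘ₗ R.ε ∘ₗ LinearMap.snd k U W else 0
  idem j := by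
    fin_cases a <;> fin_cases j <;> ext x <;> simp [A3]
  orth i j h := by
    fin_cases a <;> fin_cases i <;> fin_cases j <;> first | exact absurd rfl h | ext x <;> simp [A3]
  one := by
    fin_cases a <;> ext x <;> simp [A3, Fin.sum_univ_three]
  tgt_arr b := by
    fin_cases a <;> fin_cases b <;> ext x <;> simp [A3]
  arr_src b := by
    fin_cases a <;> fin_cases b <;> ext x <;> simp [A3]
  tgt_eps j := by
    fin_cases a <;> fin_cases j <;> ext x <;> simp [A3]
  eps_src j := by
    fin_cases a <;> fin_cases j <;> ext x <;> simp [A3]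
  nil j := by
    fin_cases j <;> ext x <;> simp [A3, R.ε_ε]
  comm b := by
    fin_cases a <;> fin_cases b <;> ext x <;> simp [A3, R.ε_α]

variable (a : Fin 2) (R : Rep k U W)

/-- The `Λ^ı`-module of a representation. -/
def Rep.toModuleCat : ModuleCat.{u} (A3.iAlg k) :=
  (ModuleCat.restrictScalars ((R.data a).lift (k := k)).toRingHom).obj
    (ModuleCat.of (Module.End k (U × W)) (U × W))

open scoped ModuleCat

/-- The underlying vector space of the `Λ^ı`-module of a representation. -/
def Rep.equiv : (U × W) ≃ₗ[k] R.toModuleCat a where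
  toFun x := x
  invFun x := x
  left_inv _ := rfl
  right_inv _ := rfl
  map_add' _ _ := rfl
  map_smul' c w := by
    have h : ((R.data a).lift (k := k)) (algebraMap k _ c) = algebraMap k _ c :=
      AlgHom.commutes _ c
    exact (congrArg (fun f : Module.End k (U × W) => f w) h).symm

variable [Module.Finite k U] [Module.Finite k W]

/-- The finite-dimensional `Λ^ı`-module of a representation. -/
def Rep.obj : A3.Mod k :=
  ⟨R.toModuleCat a, Module.Finite.of_surjective (R.equiv a).toLinearMap (R.equiv a).surjective⟩

/-- The underlying vector space of the `Λ^ı`-module of a representation. -/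
def Rep.objEquiv : (U × W) ≃ₗ[k] (R.obj a).obj := R.equiv a

theorem Rep.smul_objEquiv (r : A3.iAlg k) (x : U × W) :
    r • R.objEquiv a x = R.objEquiv a ((R.data a).lift (k := k) r x) := rfl

theorem Rep.idem_src_smul (x : U × W) :
    A3.idem k (A3.src a) • R.objEquiv a x = R.objEquiv a (x.1, 0) := by
  rw [smul_objEquiv, RepData.lift_idem]
  simp [Rep.data]

theorem Rep.idem_one_smul (x : U × W) :
    A3.idem k 1 • R.objEquiv a x = R.objEquiv a (0, x.2) := by
  have : (1 : Fin 3) ≠ A3.src a := by fin_cases a <;> decide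
  rw [smul_objEquiv, RepData.lift_idem]
  simp [Rep.data, this]

theorem Rep.idem_smul_of_ne {j : Fin 3} (h : j ≠ A3.src a) (h' : j ≠ 1) (x : U × W) :
    A3.idem k j • R.objEquiv a x = 0 := by
  rw [smul_objEquiv, RepData.lift_idem]
  simp [Rep.data, h, h']

theorem Rep.iArr_smul (x : U × W) :
    A3.iArr k a • R.objEquiv a x = R.objEquiv a (0, R.α x.1) := by
  rw [smul_objEquiv, RepData.lift_iArr]
  simp [Rep.data]

theorem Rep.iArr_smul_of_ne {b : Fin 2} (h : b ≠ a) (x : U × W) :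
    A3.iArr k b • R.objEquiv a x = 0 := by
  rw [smul_objEquiv, RepData.lift_iArr]
  simp [Rep.data, h]

theorem Rep.iEps_one_smul (x : U × W) :
    A3.iEps k 1 • R.objEquiv a x = R.objEquiv a (0, R.ε x.2) := by
  rw [smul_objEquiv, RepData.lift_iEps]
  simp [Rep.data]

theorem Rep.iEps_smul_of_ne {j : Fin 3} (h : j ≠ 1) (x : U × W) :
    A3.iEps k j • R.objEquiv a x = 0 := by
  rw [smul_objEquiv, RepData.lift_iEps]
  simp [Rep.data, h]

end

end IQuiver
end

/-! ### Modules supported at i and 2 as pairs (α, ε), and their morphisms -/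

noncomputable section
namespace IQuiver

open scoped ModuleCat

variable {k : Type u} [Field k]

theorem A3_src_ne_one (a : Fin 2) : A3.src a ≠ 1 := by fin_cases a <;> decide

section

variable {U W : Type u} [AddCommGroup U] [Module k U] [AddCommGroup W] [Module k W]
  [Module.Finite k U] [Module.Finite k W] (a : Fin 2)

/-- A linear map from a representation that is compatible with the structure, as a morphism. -/
def Rep.desc (R : Rep k U W) {E : A3.Mod k} (φ : (U × W) →ₗ[k] E.obj)
    (hs : ∀ x, A3.idem k (A3.src a) • φ x = φ (x.1, 0))
    (h1 : ∀ x, A3.idem k 1 • φ x = φ (0, x.2))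
    (ha : ∀ x, A3.iArr k a • φ x = φ (0, R.α x.1))
    (he : ∀ x, A3.iEps k 1 • φ x = φ (0, R.ε x.2))
    (he' : ∀ u, A3.iEps k (A3.src a) • φ (u, 0) = 0) : R.obj a ⟶ E := by
  have hsum : ∀ x, φ x = A3.idem k (A3.src a) • φ x + A3.idem k 1 • φ x := fun x => by
    rw [hs, h1, ← map_add]; simp
  have horth : ∀ j, j ≠ A3.src a → j ≠ 1 → ∀ x, A3.idem k j • φ x = 0 := fun j hj hj' x => by
    rw [hsum, smul_add, ← mul_smul, ← mul_smul, A3.idem_mul_idem_of_ne k hj,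
      A3.idem_mul_idem_of_ne k hj', zero_smul, add_zero]
  refine homOf (φ ∘ₗ (R.objEquiv a).symm.toLinearMap) ?_ ?_ ?_
  · intro j x
    obtain ⟨x, rfl⟩ := (R.objEquiv a).surjective x
    by_cases hj : j = A3.src a
    · subst hj; simp [R.idem_src_smul, hs]
    · by_cases hj' : j = 1
      · subst hj'; simp [R.idem_one_smul, h1]
      · simp [R.idem_smul_of_ne a hj hj', horth j hj hj']
  · intro b x
    obtain ⟨x, rfl⟩ := (R.objEquiv a).surjective x
    by_cases hb : b = a
    · subst hb; simp [R.iArr_smul, ha]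
    -- The two arrows have different sources, so the other arrow starts at the third vertex, where
    -- the image of `φ` has no component.
    · have h : A3.src b ≠ A3.src a := by
        revert hb; fin_cases a <;> fin_cases b <;> decide
      have : A3.iArr k b • φ x = 0 := by
        rw [← A3.iArr_mul_idem k b, mul_smul]
        exact (congrArg _ (horth _ h (A3_src_ne_one b) x)).trans (smul_zero _)
      simp [R.iArr_smul_of_ne a hb, this]
  · intro j x
    obtain ⟨x, rfl⟩ := (R.objEquiv a).surjective x
    by_cases hj' : j = 1
    · subst hj'; simp [R.iEps_one_smul, he]
    · have : A3.iEps k j • φ x = 0 := by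
        rw [← A3.iEps_mul_idem k j, mul_smul]
        by_cases hj : j = A3.src a
        · subst hj
          exact (congrArg _ (hs x)).trans (he' _)
        · exact (congrArg _ (horth _ hj hj' x)).trans (smul_zero _)
      simp [R.iEps_smul_of_ne a hj', this]

/-- A module that is supported at the source of `a` and at the vertex `2` comes from a
representation. -/
theorem exists_rep {E : A3.Mod k} (φ : (U × W) ≃ₗ[k] E.obj)
    (hs : ∀ x, A3.idem k (A3.src a) • φ x = φ (x.1, 0))
    (h1 : ∀ x, A3.idem k 1 • φ x = φ (0, x.2)) :
    ∃ (R : Rep k U W) (f : R.obj a ⟶ E), IsIso f ∧ ∀ x, linOf f (R.objEquiv a x) = φ x := by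
  let L : A3.iAlg k → E.obj →ₗ[k] E.obj := fun r => Algebra.lsmul k k E.obj r
  let α : U →ₗ[k] W := LinearMap.snd k U W ∘ₗ φ.symm.toLinearMap ∘ₗ L (A3.iArr k a) ∘ₗ
    φ.toLinearMap ∘ₗ LinearMap.inl k U W
  let ε : W →ₗ[k] W := LinearMap.snd k U W ∘ₗ φ.symm.toLinearMap ∘ₗ L (A3.iEps k 1) ∘ₗ
    φ.toLinearMap ∘ₗ LinearMap.inr k U W
  -- Elements fixed by the idempotent at 2 lie in the image of `W`. The arrow `a` and the loop end
  -- at 2, so nothing is lost when their values are projected to `W`.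
  have hL : ∀ y : E.obj, A3.idem k 1 • y = y → φ (0, (φ.symm y).2) = y := by
    intro y hy
    rw [← h1, LinearEquiv.apply_symm_apply, hy]
  have hs' : ∀ x : U × W, φ (x.1, 0) = A3.idem k (A3.src a) • φ x := fun x => (hs x).symm
  have ha : ∀ x, A3.iArr k a • φ x = φ (0, α x.1) := by
    intro x
    have e : A3.iArr k a • φ x = A3.iArr k a • φ (x.1, 0) := by
      rw [← hs, ← mul_smul]
      exact congrArg (· • φ x) (A3.iArr_mul_idem k a).symm
    rw [e]
    refine (hL _ ?_).symm
    rw [← mul_smul]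
    have ht : A3.tgt a = 1 := by fin_cases a <;> rfl
    have := A3.idem_mul_iArr k a
    rw [ht] at this
    exact congrArg (· • φ (x.1, 0)) this
  have he : ∀ x, A3.iEps k 1 • φ x = φ (0, ε x.2) := by
    intro x
    have e : A3.iEps k 1 • φ x = A3.iEps k 1 • φ (0, x.2) := by
      rw [← h1, ← mul_smul]
      exact congrArg (· • φ x) (A3.iEps_mul_idem k 1).symm
    rw [e]
    refine (hL _ ?_).symm
    rw [← mul_smul]
    exact congrArg (· • φ (0, x.2)) (A3.idem_mul_iEps k 1)
  have horth : ∀ j, j ≠ A3.src a → j ≠ 1 → ∀ y : E.obj, A3.idem k j • y = 0 := fun j hj hj' y => by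
    obtain ⟨x, rfl⟩ := φ.surjective y
    have hsum : φ x = A3.idem k (A3.src a) • φ x + A3.idem k 1 • φ x := by
      rw [hs, h1, ← map_add]; simp
    rw [hsum, smul_add, ← mul_smul, ← mul_smul, A3.idem_mul_idem_of_ne k hj,
      A3.idem_mul_idem_of_ne k hj', zero_smul, add_zero]
  -- This ε ends at the third vertex, where the module is zero. Through ε_2 α = (τα) ε_i it yields
  -- the relation εα = 0.
  have he' : ∀ u, A3.iEps k (A3.src a) • φ (u, 0) = 0 := by
    intro u
    have h2 : A3.τ (A3.src a) ≠ A3.src a := by fin_cases a <;> decide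
    have h3 : A3.τ (A3.src a) ≠ 1 := by fin_cases a <;> decide
    rw [← A3.idem_mul_iEps k, mul_smul]
    exact horth _ h2 h3 _
  have hinj : ∀ {w w' : W}, φ (0, w) = φ (0, w') → w = w' := fun h => (Prod.mk.inj (φ.injective h)).2
  let R : Rep k U W :=
    { α := α
      ε := ε
      ε_α := fun u => by
        apply hinj
        rw [← he (0, α u), ← ha (u, 0), ← mul_smul]
        have ht : A3.tgt a = 1 := by fin_cases a <;> rfl
        have := A3.iEps_mul_iArr k a
        rw [ht] at this
        refine (congrArg (· • φ (u, 0)) this).trans ?_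
        refine (mul_smul _ _ _).trans ?_
        refine (congrArg _ (he' u)).trans ?_
        rw [smul_zero, ← map_zero φ]
        rfl
      ε_ε := fun w => by
        apply hinj
        rw [← he (0, ε w), ← he (0, w), ← mul_smul]
        refine (congrArg (· • φ (0, w)) (A3.iEps_mul_iEps k 1)).trans ?_
        rw [zero_smul, ← map_zero φ]
        rfl }
  refine ⟨R, R.desc a φ.toLinearMap hs h1 ha he he', ?_, fun x => rfl⟩
  exact isIso_of_bijective _ (φ.bijective.comp (R.objEquiv a).symm.bijective)

end

section

variable {U W U' W' : Type u} [AddCommGroup U] [Module k U] [AddCommGroup W] [Module k W]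
  [Module.Finite k U] [Module.Finite k W] [AddCommGroup U'] [Module k U'] [AddCommGroup W']
  [Module k W'] [Module.Finite k U'] [Module.Finite k W'] (a : Fin 2)

/-- A morphism of representations. -/
def Rep.hom {R : Rep k U W} {R' : Rep k U' W'} (σ : U →ₗ[k] U') (ω : W →ₗ[k] W')
    (hα : ∀ u, ω (R.α u) = R'.α (σ u)) (hε : ∀ w, ω (R.ε w) = R'.ε (ω w)) :
    R.obj a ⟶ R'.obj a :=
  R.desc a ((R'.objEquiv a).toLinearMap ∘ₗ σ.prodMap ω)
    (fun x => by simp [R'.idem_src_smul]) (fun x => by simp [R'.idem_one_smul])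
    (fun x => by simp [R'.iArr_smul, hα]) (fun x => by simp [R'.iEps_one_smul, hε])
    (fun u => by simp [R'.iEps_smul_of_ne a (A3_src_ne_one a)])

theorem Rep.linOf_hom {R : Rep k U W} {R' : Rep k U' W'} (σ : U →ₗ[k] U') (ω : W →ₗ[k] W')
    (hα : ∀ u, ω (R.α u) = R'.α (σ u)) (hε : ∀ w, ω (R.ε w) = R'.ε (ω w)) (x : U × W) :
    linOf (Rep.hom a σ ω hα hε) (R.objEquiv a x) = R'.objEquiv a (σ x.1, ω x.2) := rfl

theorem Rep.exists_eq_hom {R : Rep k U W} {R' : Rep k U' W'} (f : R.obj a ⟶ R'.obj a) :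
    ∃ (σ : U →ₗ[k] U') (ω : W →ₗ[k] W') (hα : ∀ u, ω (R.α u) = R'.α (σ u))
      (hε : ∀ w, ω (R.ε w) = R'.ε (ω w)), f = Rep.hom a σ ω hα hε := by
  let F : U × W →ₗ[k] U' × W' :=
    (R'.objEquiv a).symm.toLinearMap ∘ₗ linOf f ∘ₗ (R.objEquiv a).toLinearMap
  have hF : ∀ x, linOf f (R.objEquiv a x) = R'.objEquiv a (F x) := fun x => by simp [F]
  have h1 : ∀ u, F (u, 0) = ((F (u, 0)).1, 0) := fun u => by
    apply (R'.objEquiv a).injective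
    rw [← R'.idem_src_smul, ← hF, ← linOf_smul, R.idem_src_smul]
  have h2 : ∀ w, F (0, w) = (0, (F (0, w)).2) := fun w => by
    apply (R'.objEquiv a).injective
    rw [← R'.idem_one_smul, ← hF, ← linOf_smul, R.idem_one_smul]
  -- Commuting with the two idempotents makes the map block diagonal.
  have h3 : ∀ x, F x = ((F (x.1, 0)).1, (F (0, x.2)).2) := fun x => by
    have : x = (x.1, 0) + (0, x.2) := by simp
    conv_lhs => rw [this, map_add, h1, h2]
    simp
  let σ : U →ₗ[k] U' := LinearMap.fst k _ _ ∘ₗ F ∘ₗ LinearMap.inl k _ _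
  let ω : W →ₗ[k] W' := LinearMap.snd k _ _ ∘ₗ F ∘ₗ LinearMap.inr k _ _
  have hα : ∀ u, ω (R.α u) = R'.α (σ u) := fun u => by
    have h := linOf_smul f (A3.iArr k a) (R.objEquiv a (u, 0))
    rw [R.iArr_smul, hF, hF, R'.iArr_smul] at h
    exact congrArg Prod.snd ((R'.objEquiv a).injective h)
  have hε : ∀ w, ω (R.ε w) = R'.ε (ω w) := fun w => by
    have h := linOf_smul f (A3.iEps k 1) (R.objEquiv a (0, w))
    rw [R.iEps_one_smul, hF, hF, R'.iEps_one_smul] at h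
    exact congrArg Prod.snd ((R'.objEquiv a).injective h)
  refine ⟨σ, ω, hα, hε, linOf_injective (LinearMap.ext fun y => ?_)⟩
  obtain ⟨x, rfl⟩ := (R.objEquiv a).surjective y
  exact ((hF x).trans (congrArg (R'.objEquiv a) (h3 x))).trans
    (Rep.linOf_hom a σ ω hα hε x).symm

theorem Rep.hcls_congr (R : Rep k U W) (R' : Rep k U' W') (σ : U ≃ₗ[k] U') (ω : W ≃ₗ[k] W')
    (hα : ∀ u, ω (R.α u) = R'.α (σ u)) (hε : ∀ w, ω (R.ε w) = R'.ε (ω w)) :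
    A3.hcls k (R.obj a) = A3.hcls k (R'.obj a) := by
  have hb : ⇑(linOf (Rep.hom a (R := R) (R' := R') σ.toLinearMap ω.toLinearMap hα hε)) =
      ((R.objEquiv a).symm ≪≫ₗ (σ.prodCongr ω) ≪≫ₗ R'.objEquiv a) := by
    funext x
    obtain ⟨x, rfl⟩ := (R.objEquiv a).surjective x
    rw [Rep.linOf_hom]
    simp
  have : IsIso (Rep.hom a (R := R) (R' := R') σ.toLinearMap ω.toLinearMap hα hε) :=
    isIso_of_bijective _ (by rw [hb]; exact LinearEquiv.bijective _)
  exact IQuiver.hcls_congr (asIso (Rep.hom a σ.toLinearMap ω.toLinearMap hα hε))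

end

end IQuiver
end

noncomputable section
namespace IQuiver

open scoped ModuleCat

attribute [local instance] HasDerivedCategory.standard HasExt.standard

variable {k : Type u} [Field k]

/-! ## Extensions of representations -/

section

variable {U W U' W' : Type u} [AddCommGroup U] [Module k U] [AddCommGroup W] [Module k W]
  [AddCommGroup U'] [Module k U'] [AddCommGroup W'] [Module k W']

theorem Rep.eq_of {R R' : Rep k U W} (h₁ : ∀ u, R.α u = R'.α u) (h₂ : ∀ w, R.ε w = R'.ε w) :
    R = R' := by
  cases R; cases R'
  congr
  · exact LinearMap.ext h₁
  · exact LinearMap.ext h₂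

variable (M : Rep k U W) (N : Rep k U' W')

/-- The off-diagonal blocks of the extensions of `M` by `N`. -/
def Rep.cocycles : AddSubgroup ((U →ₗ[k] W') × (W →ₗ[k] W')) where
  carrier := {z | (∀ u, N.ε (z.1 u) + z.2 (M.α u) = 0) ∧ ∀ w, N.ε (z.2 w) + z.2 (M.ε w) = 0}
  zero_mem' := by simp
  add_mem' {x y} hx hy := by
    refine ⟨fun u => ?_, fun w => ?_⟩
    · have := congrArg₂ (· + ·) (hx.1 u) (hy.1 u)
      simp only [add_zero] at this
      rw [← this]
      simp only [Prod.fst_add, Prod.snd_add, LinearMap.add_apply, map_add]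
      abel
    · have := congrArg₂ (· + ·) (hx.2 w) (hy.2 w)
      simp only [add_zero] at this
      rw [← this]
      simp only [Prod.snd_add, LinearMap.add_apply, map_add]
      abel
  neg_mem' {x} hx := by
    refine ⟨fun u => ?_, fun w => ?_⟩
    · have := congrArg Neg.neg (hx.1 u)
      simpa [add_comm] using this
    · have := congrArg Neg.neg (hx.2 w)
      simpa [add_comm] using this

/-- The coboundary map, whose kernel is the space of morphisms from `M` to `N`. -/
def Rep.cobound : ((U →ₗ[k] U') × (W →ₗ[k] W')) →+ M.cocycles N where
  toFun h := ⟨(N.α ∘ₗ h.1 - h.2 ∘ₗ M.α, N.ε ∘ₗ h.2 - h.2 ∘ₗ M.ε), by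
    refine ⟨fun u => ?_, fun w => ?_⟩
    · simp [N.ε_α, M.ε_α]
    · simp [N.ε_ε, M.ε_ε]⟩
  map_zero' := by
    apply Subtype.ext
    simp
  map_add' x y := by
    apply Subtype.ext
    ext u <;> simp <;> abel

/-- The extension of `M` by `N` with given off-diagonal blocks. -/
def Rep.ext (z : M.cocycles N) : Rep k (U' × U) (W' × W) where
  α := (N.α ∘ₗ LinearMap.fst k U' U + z.1.1 ∘ₗ LinearMap.snd k U' U).prod
    (M.α ∘ₗ LinearMap.snd k U' U)
  ε := (N.ε ∘ₗ LinearMap.fst k W' W + z.1.2 ∘ₗ LinearMap.snd k W' W).prod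
    (M.ε ∘ₗ LinearMap.snd k W' W)
  ε_α u := by
    have := z.2.1 u.2
    simp [N.ε_α, M.ε_α, this]
  ε_ε w := by
    have := z.2.2 w.2
    simp [N.ε_ε, M.ε_ε, this]

theorem Rep.ext_α (z : M.cocycles N) (u : U' × U) :
    (M.ext N z).α u = (N.α u.1 + z.1.1 u.2, M.α u.2) := rfl

theorem Rep.ext_ε (z : M.cocycles N) (w : W' × W) :
    (M.ext N z).ε w = (N.ε w.1 + z.1.2 w.2, M.ε w.2) := rfl

variable [Module.Finite k U] [Module.Finite k W] [Module.Finite k U'] [Module.Finite k W']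
  (a : Fin 2)

/-- The inclusion in an extension. -/
def Rep.extIncl (z : M.cocycles N) : N.obj a ⟶ (M.ext N z).obj a :=
  Rep.hom a (LinearMap.inl k U' U) (LinearMap.inl k W' W) (fun u => by simp [ext_α])
    (fun w => by simp [ext_ε])

/-- The projection of an extension. -/
def Rep.extProj (z : M.cocycles N) : (M.ext N z).obj a ⟶ M.obj a :=
  Rep.hom a (LinearMap.snd k U' U) (LinearMap.snd k W' W) (fun u => by simp [ext_α])
    (fun w => by simp [ext_ε])

theorem Rep.extIncl_apply (z : M.cocycles N) (x : U' × W') :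
    linOf (Rep.extIncl M N a z) (N.objEquiv a x) = (M.ext N z).objEquiv a ((x.1, 0), (x.2, 0)) :=
  rfl

theorem Rep.extProj_apply (z : M.cocycles N) (x : (U' × U) × (W' × W)) :
    linOf (Rep.extProj M N a z) ((M.ext N z).objEquiv a x) = M.objEquiv a (x.1.2, x.2.2) :=
  rfl

theorem Rep.extIncl_extProj (z : M.cocycles N) :
    Rep.extIncl M N a z ≫ Rep.extProj M N a z = 0 := by
  apply linOf_injective
  refine LinearMap.ext fun y => ?_
  obtain ⟨x, rfl⟩ := (N.objEquiv a).surjective y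
  rw [linOf_comp, LinearMap.comp_apply, extIncl_apply, extProj_apply]
  exact map_zero _

theorem Rep.ext_shortExact (z : M.cocycles N) :
    (ShortComplex.mk _ _ (Rep.extIncl_extProj M N a z)).ShortExact := by
  apply shortExact_of_linOf
  · intro y y' h
    obtain ⟨x, rfl⟩ := (N.objEquiv a).surjective y
    obtain ⟨x', rfl⟩ := (N.objEquiv a).surjective y'
    dsimp only at h
    rw [extIncl_apply, extIncl_apply] at h
    have := ((M.ext N z).objEquiv a).injective h
    simp only [Prod.mk.injEq, and_true] at this
    rw [Prod.ext this.1 this.2]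
  · intro y
    obtain ⟨x, rfl⟩ := ((M.ext N z).objEquiv a).surjective y
    constructor
    · intro h
      dsimp only at h
      rw [extProj_apply, LinearEquiv.map_eq_zero_iff] at h
      refine ⟨N.objEquiv a (x.1.1, x.2.1), ?_⟩
      rw [extIncl_apply, ← (Prod.mk.inj h).1, ← (Prod.mk.inj h).2]
    · rintro ⟨y, hy⟩
      rw [← hy, ← LinearMap.comp_apply, ← linOf_comp]
      dsimp only
      rw [Rep.extIncl_extProj]
      rfl
  · intro y
    obtain ⟨x, rfl⟩ := (M.objEquiv a).surjective y
    exact ⟨(M.ext N z).objEquiv a ((0, x.1), (0, x.2)), Rep.extProj_apply M N a z _⟩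

/-- The class of an extension. -/
def Rep.extCls (z : M.cocycles N) : Abelian.Ext.{u + 1} (M.obj a) (N.obj a) 1 :=
  (Rep.ext_shortExact M N a z).extClass

/-- An equivalence of extensions is a pair of unipotent block matrices. Compatibility with α and ε,
read in the upper right corner, is the coboundary equation for their off-diagonal entries. -/
theorem Rep.exists_cobound {z z' : M.cocycles N} (φ : (M.ext N z).obj a ⟶ (M.ext N z').obj a)
    (h₁ : Rep.extIncl M N a z ≫ φ = Rep.extIncl M N a z')
    (h₂ : φ ≫ Rep.extProj M N a z' = Rep.extProj M N a z) : ∃ h, M.cobound N h = z - z' := by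
  obtain ⟨σ, ω, hα, hε, hφ⟩ := Rep.exists_eq_hom a φ
  replace hφ : ∀ x, linOf φ ((M.ext N z).objEquiv a x) = (M.ext N z').objEquiv a
      (σ x.1, ω x.2) := fun x => by rw [hφ]; exact Rep.linOf_hom a σ ω hα hε x
  have e₁ : ∀ u w, σ (u, 0) = (u, 0) ∧ ω (w, 0) = (w, 0) := fun u w => by
    have := congrArg (fun f : N.obj a ⟶ (M.ext N z').obj a => linOf f (N.objEquiv a (u, w))) h₁
    simp only [linOf_comp, LinearMap.comp_apply, extIncl_apply, hφ] at this
    exact Prod.mk.inj (((M.ext N z').objEquiv a).injective this)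
  have e₂ : ∀ x : (U' × U) × (W' × W), (σ x.1).2 = x.1.2 ∧ (ω x.2).2 = x.2.2 := fun x => by
    have := congrArg (fun f : (M.ext N z).obj a ⟶ M.obj a =>
      linOf f ((M.ext N z).objEquiv a x)) h₂
    simp only [linOf_comp, LinearMap.comp_apply, extProj_apply, hφ] at this
    exact Prod.mk.inj ((M.objEquiv a).injective this)
  let s : U →ₗ[k] U' := LinearMap.fst k U' U ∘ₗ σ ∘ₗ LinearMap.inr k U' U
  let t : W →ₗ[k] W' := LinearMap.fst k W' W ∘ₗ ω ∘ₗ LinearMap.inr k W' W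
  have hσ : ∀ u, σ (0, u) = (s u, u) := fun u => Prod.ext rfl (e₂ ((0, u), 0)).1
  have hω : ∀ w, ω w = (w.1 + t w.2, w.2) := fun w => by
    have h0 : w = (w.1, 0) + (0, w.2) := by simp
    have h3 : ω (0, w.2) = (t w.2, w.2) := Prod.ext rfl (e₂ (0, (0, w.2))).2
    conv_lhs => rw [h0, map_add, (e₁ 0 w.1).2, h3]
    simp
  refine ⟨(s, t), Subtype.ext (Prod.ext (LinearMap.ext fun u => ?_) (LinearMap.ext fun w => ?_))⟩
  · have := hα (0, u)
    rw [ext_α, hω, hσ, ext_α] at this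
    have := (Prod.mk.inj this).1
    simp only [map_zero, zero_add] at this
    change N.α (s u) - t (M.α u) = z.1.1 u - z'.1.1 u
    rw [sub_eq_sub_iff_add_eq_add, ← this]
  · have := hε (0, w)
    rw [ext_ε, hω, hω, ext_ε] at this
    have := (Prod.mk.inj this).1
    simp only [map_zero, zero_add] at this
    change N.ε (t w) - t (M.ε w) = z.1.2 w - z'.1.2 w
    rw [sub_eq_sub_iff_add_eq_add, ← this]

theorem Rep.exists_hom_of_cobound {z z' : M.cocycles N} (h) (e : M.cobound N h = z - z') :
    ∃ φ : (M.ext N z).obj a ⟶ (M.ext N z').obj a,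
      Rep.extIncl M N a z ≫ φ = Rep.extIncl M N a z' ∧
      φ ≫ Rep.extProj M N a z' = Rep.extProj M N a z := by
  have ha : ∀ u, z.1.1 u + h.2 (M.α u) = N.α (h.1 u) + z'.1.1 u := fun u => by
    have : N.α (h.1 u) - h.2 (M.α u) = z.1.1 u - z'.1.1 u :=
      congrArg (fun z : M.cocycles N => z.1.1 u) e
    rw [sub_eq_sub_iff_add_eq_add] at this
    exact this.symm
  have hc : ∀ w, z.1.2 w + h.2 (M.ε w) = N.ε (h.2 w) + z'.1.2 w := fun w => by
    have : N.ε (h.2 w) - h.2 (M.ε w) = z.1.2 w - z'.1.2 w :=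
      congrArg (fun z : M.cocycles N => z.1.2 w) e
    rw [sub_eq_sub_iff_add_eq_add] at this
    exact this.symm
  let φ : (M.ext N z).obj a ⟶ (M.ext N z').obj a := Rep.hom a
    ((LinearMap.fst k U' U + h.1 ∘ₗ LinearMap.snd k U' U).prod (LinearMap.snd k U' U))
    ((LinearMap.fst k W' W + h.2 ∘ₗ LinearMap.snd k W' W).prod (LinearMap.snd k W' W))
    (fun u => by simp [ext_α, add_assoc, ha]) (fun u => by simp [ext_ε, add_assoc, hc])
  have hφ : ∀ x, linOf φ ((M.ext N z).objEquiv a x) = (M.ext N z').objEquiv a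
      ((x.1.1 + h.1 x.1.2, x.1.2), (x.2.1 + h.2 x.2.2, x.2.2)) := fun x => rfl
  refine ⟨φ, linOf_injective (LinearMap.ext fun y => ?_),
    linOf_injective (LinearMap.ext fun y => ?_)⟩
  · obtain ⟨x, rfl⟩ := (N.objEquiv a).surjective y
    rw [linOf_comp, LinearMap.comp_apply, extIncl_apply, extIncl_apply, hφ]
    simp
  · obtain ⟨x, rfl⟩ := ((M.ext N z).objEquiv a).surjective y
    rw [linOf_comp, LinearMap.comp_apply, hφ, extProj_apply, extProj_apply]

theorem Rep.extCls_eq_iff {z z' : M.cocycles N} :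
    Rep.extCls M N a z = Rep.extCls M N a z' ↔ z - z' ∈ (M.cobound N).range := by
  constructor
  · intro e
    obtain ⟨φ, h₁, h₂⟩ := HallAlg.exists_hom_of_extClass_eq _ _ e
    exact Rep.exists_cobound M N a φ h₁ h₂
  · rintro ⟨h, e⟩
    obtain ⟨φ, h₁, h₂⟩ := Rep.exists_hom_of_cobound M N a h e
    exact HallAlg.extClass_eq_of_hom _ _ φ h₁ h₂

/-- A map of short exact sequences that is the identity at both ends is invertible in the middle.
The set of cocycles with a prescribed middle term is thus a union of cosets of the coboundaries. -/
theorem Rep.isoCls_eq_of_extCls_eq {z z' : M.cocycles N}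
    (e : Rep.extCls M N a z = Rep.extCls M N a z') :
    HallAlg.isoCls ((M.ext N z).obj a) = HallAlg.isoCls ((M.ext N z').obj a) := by
  obtain ⟨φ, h₁, h₂⟩ := HallAlg.exists_hom_of_extClass_eq _ _ e
  let Φ : ShortComplex.mk _ _ (Rep.extIncl_extProj M N a z) ⟶
      ShortComplex.mk _ _ (Rep.extIncl_extProj M N a z') :=
    { τ₁ := 𝟙 _, τ₂ := φ, τ₃ := 𝟙 _, comm₁₂ := by simp [h₁], comm₂₃ := by simp [h₂] }
  have i₁ : IsIso Φ.τ₁ := inferInstanceAs (IsIso (𝟙 (N.obj a)))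
  have i₃ : IsIso Φ.τ₃ := inferInstanceAs (IsIso (𝟙 (M.obj a)))
  have : IsIso φ := ShortComplex.isIso₂_of_shortExact_of_isIso₁₃ Φ
    (Rep.ext_shortExact M N a z) (Rep.ext_shortExact M N a z')
  exact Quotient.sound ⟨asIso φ⟩

end

end IQuiver
end

/-! ### Every extension comes from a cocycle; structure constants by counting cocycles -/

noncomputable section
namespace IQuiver

open scoped ModuleCat

attribute [local instance] HasDerivedCategory.standard HasExt.standard

variable {k : Type u} [Field k]

section

variable {U W U' W' : Type u} [AddCommGroup U] [Module k U] [AddCommGroup W] [Module k W]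
  [AddCommGroup U'] [Module k U'] [AddCommGroup W'] [Module k W']
  (M : Rep k U W) (N : Rep k U' W')
  [Module.Finite k U] [Module.Finite k W] [Module.Finite k U'] [Module.Finite k W']
  (a : Fin 2)

omit [Module.Finite k U'] [Module.Finite k W'] in
/-- An epimorphism onto a representation has a linear section that is compatible with the
idempotents. -/
theorem Rep.exists_section {E : A3.Mod k} (g : E ⟶ M.obj a) (hg : Function.Surjective (linOf g)) :
    ∃ s : U × W →ₗ[k] E.obj, (∀ x, A3.idem k (A3.src a) • s x = s (x.1, 0)) ∧
      (∀ x, A3.idem k 1 • s x = s (0, x.2)) ∧ ∀ x, linOf g (s x) = M.objEquiv a x := by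
  obtain ⟨s₀, hs₀⟩ := (linOf g).exists_rightInverse_of_surjective (LinearMap.range_eq_top.2 hg)
  replace hs₀ : ∀ y, linOf g (s₀ y) = y := fun y => DFunLike.congr_fun hs₀ y
  let m : A3.iAlg k → E.obj →ₗ[k] E.obj := fun r => Algebra.lsmul k k E.obj r
  -- An arbitrary linear section `s₀` is cut down by the idempotents: one component at i and one at
  -- 2.
  let s : U × W →ₗ[k] E.obj :=
    m (A3.idem k (A3.src a)) ∘ₗ s₀ ∘ₗ (M.objEquiv a).toLinearMap ∘ₗ
        LinearMap.inl k U W ∘ₗ LinearMap.fst k U W +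
      m (A3.idem k 1) ∘ₗ s₀ ∘ₗ (M.objEquiv a).toLinearMap ∘ₗ
        LinearMap.inr k U W ∘ₗ LinearMap.snd k U W
  have hs : ∀ x, s x = A3.idem k (A3.src a) • s₀ (M.objEquiv a (x.1, 0)) +
      A3.idem k 1 • s₀ (M.objEquiv a (0, x.2)) := fun x => rfl
  have hne := A3_src_ne_one a
  have h0 : M.objEquiv a ((0 : U), (0 : W)) = 0 := map_zero _
  refine ⟨s, fun x => ?_, fun x => ?_, fun x => ?_⟩
  · rw [hs, hs, smul_add, ← mul_smul, ← mul_smul, idem_mul_idem, idem_mul_idem_of_ne _ _ hne,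
      zero_smul]
    dsimp only
    rw [h0, map_zero, smul_zero]
  · rw [hs, hs, smul_add, ← mul_smul, ← mul_smul, idem_mul_idem, idem_mul_idem_of_ne _ _ hne.symm,
      zero_smul]
    dsimp only
    rw [h0, map_zero, smul_zero]
  · rw [hs, map_add, linOf_smul, linOf_smul, hs₀, hs₀, Rep.idem_src_smul, Rep.idem_one_smul,
      ← map_add]
    simp

/-- An extension of representations splits, compatibly with the idempotents. -/
theorem Rep.exists_splitting {E : A3.Mod k} {f : N.obj a ⟶ E} {g : E ⟶ M.obj a} {w : f ≫ g = 0}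
    (h : (ShortComplex.mk f g w).ShortExact) :
    ∃ Φ : ((U' × U) × (W' × W)) ≃ₗ[k] E.obj,
      (∀ x, A3.idem k (A3.src a) • Φ x = Φ (x.1, 0)) ∧
      (∀ x, A3.idem k 1 • Φ x = Φ (0, x.2)) ∧
      (∀ x, linOf g (Φ x) = M.objEquiv a (x.1.2, x.2.2)) ∧
      ∀ x : U' × W', linOf f (N.objEquiv a x) = Φ ((x.1, 0), (x.2, 0)) := by
  obtain ⟨hf, hfg, hg⟩ := linOf_shortExact h
  dsimp only at hf hfg hg
  obtain ⟨s, s_src, s_one, gs⟩ := Rep.exists_section M a g hg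
  have gf : ∀ x, linOf g (linOf f x) = 0 := fun x => (hfg _).2 ⟨x, rfl⟩
  let j : U' × W' →ₗ[k] E.obj := linOf f ∘ₗ (N.objEquiv a).toLinearMap
  have hj : ∀ x, j x = linOf f (N.objEquiv a x) := fun _ => rfl
  have gj : ∀ x, linOf g (j x) = 0 := fun x => gf _
  have j_src : ∀ x, A3.idem k (A3.src a) • j x = j (x.1, 0) := fun x => by
    rw [hj, hj, ← linOf_smul, Rep.idem_src_smul]
  have j_one : ∀ x, A3.idem k 1 • j x = j (0, x.2) := fun x => by
    rw [hj, hj, ← linOf_smul, Rep.idem_one_smul]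
  have j_inj : ∀ x, j x = 0 → x = 0 := fun x hx =>
    (LinearEquiv.map_eq_zero_iff (N.objEquiv a)).1 (hf (hx.trans (map_zero _).symm))
  have j_range : ∀ y, linOf g y = 0 → ∃ x, j x = y := fun y hy => by
    obtain ⟨n, hn⟩ := (hfg _).1 hy
    exact ⟨(N.objEquiv a).symm n, by rw [hj, LinearEquiv.apply_symm_apply, hn]⟩
  -- The splitting is the inclusion of `N` plus the section of `M`, with the coordinates regrouped
  -- by vertex as in `Rep.ext`.
  let F : (U' × U) × (W' × W) →ₗ[k] E.obj :=
    j ∘ₗ (LinearMap.fst k U' U).prodMap (LinearMap.fst k W' W) +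
    s ∘ₗ (LinearMap.snd k U' U).prodMap (LinearMap.snd k W' W)
  have hF : ∀ x, F x = j (x.1.1, x.2.1) + s (x.1.2, x.2.2) := fun x => rfl
  have gF : ∀ x, linOf g (F x) = M.objEquiv a (x.1.2, x.2.2) := fun x => by
    rw [hF, map_add, gj, gs, zero_add]
  have bij : Function.Bijective F := by
    constructor
    · refine (injective_iff_map_eq_zero F).2 fun x hx => ?_
      have h1 := gF x
      rw [hx, map_zero] at h1
      have h2 := (LinearEquiv.map_eq_zero_iff _).1 h1.symm
      have h3 := hF x
      rw [hx, h2, map_zero, add_zero] at h3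
      have h4 := j_inj _ h3.symm
      obtain ⟨h5, h6⟩ := Prod.mk.inj h2
      obtain ⟨h7, h8⟩ := Prod.mk.inj h4
      exact Prod.ext (Prod.ext h7 h5) (Prod.ext h8 h6)
    · intro y
      obtain ⟨x, hx⟩ := (M.objEquiv a).surjective (linOf g y)
      have h1 : linOf g (y - s x) = 0 := by rw [map_sub, gs, hx, sub_self]
      obtain ⟨x', hx'⟩ := j_range _ h1
      refine ⟨((x'.1, x.1), (x'.2, x.2)), ?_⟩
      rw [hF]
      exact (congrArg (· + s x) hx').trans (sub_add_cancel _ _)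
  refine ⟨LinearEquiv.ofBijective F bij, fun x => ?_, fun x => ?_, gF, fun x => ?_⟩
  · change A3.idem k (A3.src a) • F x = F (x.1, 0)
    rw [hF, hF, smul_add, s_src, j_src]
    rfl
  · change A3.idem k 1 • F x = F (0, x.2)
    rw [hF, hF, smul_add, s_one, j_one]
    rfl
  · change linOf f (N.objEquiv a x) = F ((x.1, 0), (x.2, 0))
    rw [hF]
    have : s ((0 : U), (0 : W)) = 0 := map_zero s
    dsimp only
    rw [this, add_zero, hj]

/-- Every extension of representations is given by off-diagonal blocks. -/
theorem Rep.exists_cocycle {E : A3.Mod k} {f : N.obj a ⟶ E} {g : E ⟶ M.obj a} {w : f ≫ g = 0}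
    (h : (ShortComplex.mk f g w).ShortExact) :
    ∃ (z : M.cocycles N) (φ : (M.ext N z).obj a ⟶ E), IsIso φ ∧
      Rep.extIncl M N a z ≫ φ = f ∧ φ ≫ g = Rep.extProj M N a z := by
  obtain ⟨F, F_src, F_one, gF, Fn⟩ := Rep.exists_splitting M N a h
  obtain ⟨R, r, hr, hrF⟩ := exists_rep a F F_src F_one
  have F_arr : ∀ x, A3.iArr k a • F x = F (0, R.α x.1) := fun x => by
    rw [← hrF, ← linOf_smul, Rep.iArr_smul, hrF]
  have F_eps : ∀ x, A3.iEps k 1 • F x = F (0, R.ε x.2) := fun x => by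
    rw [← hrF, ← linOf_smul, Rep.iEps_one_smul, hrF]
  -- The map `f` being a morphism fixes the left column of the block matrices of `R`, and `g` being
  -- one fixes the bottom row. Only the upper right corners `b` and `c` remain free, and the
  -- relations of `R` say that they form a cocycle.
  have α₁ : ∀ u, R.α (u, 0) = (N.α u, 0) := fun u => by
    have h1 := F_arr ((u, 0), ((0 : W'), (0 : W)))
    have h2 := Fn (u, 0)
    have h3 := linOf_smul f (A3.iArr k a) (N.objEquiv a (u, 0))
    rw [Rep.iArr_smul, Fn, h2] at h3
    exact (Prod.mk.inj (F.injective (h3.trans h1))).2.symm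
  have ε₁ : ∀ w, R.ε (w, 0) = (N.ε w, 0) := fun u => by
    have h1 := F_eps (((0 : U'), (0 : U)), (u, 0))
    have h2 := Fn (0, u)
    have h3 := linOf_smul f (A3.iEps k 1) (N.objEquiv a (0, u))
    rw [Rep.iEps_one_smul, Fn, h2] at h3
    exact (Prod.mk.inj (F.injective (h3.trans h1))).2.symm
  have α₂ : ∀ u, (R.α u).2 = M.α u.2 := fun u => by
    have h1 := congrArg (linOf g) (F_arr (u, 0))
    rw [linOf_smul, gF, gF, Rep.iArr_smul] at h1
    exact (Prod.mk.inj ((M.objEquiv a).injective h1)).2.symm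
  have ε₂ : ∀ w, (R.ε w).2 = M.ε w.2 := fun u => by
    have h1 := congrArg (linOf g) (F_eps (0, u))
    rw [linOf_smul, gF, gF, Rep.iEps_one_smul] at h1
    exact (Prod.mk.inj ((M.objEquiv a).injective h1)).2.symm
  let b : U →ₗ[k] W' := LinearMap.fst k W' W ∘ₗ R.α ∘ₗ LinearMap.inr k U' U
  let c : W →ₗ[k] W' := LinearMap.fst k W' W ∘ₗ R.ε ∘ₗ LinearMap.inr k W' W
  have hα : ∀ u, R.α u = (N.α u.1 + b u.2, M.α u.2) := fun u => by
    have h0 : u = (u.1, 0) + (0, u.2) := by simp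
    refine Prod.ext ?_ (α₂ u)
    conv_lhs => rw [h0, map_add, α₁]
    rfl
  have hε : ∀ w, R.ε w = (N.ε w.1 + c w.2, M.ε w.2) := fun w => by
    have h0 : w = (w.1, 0) + (0, w.2) := by simp
    refine Prod.ext ?_ (ε₂ w)
    conv_lhs => rw [h0, map_add, ε₁]
    rfl
  let z : M.cocycles N := ⟨(b, c), fun u => by
      have := R.ε_α (0, u)
      rw [hα, hε] at this
      simpa using congrArg Prod.fst this, fun w => by
      have := R.ε_ε (0, w)
      rw [hε, hε] at this
      simpa using congrArg Prod.fst this⟩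
  have key : ∀ R' : Rep k (U' × U) (W' × W), R' = R → ∃ φ : R'.obj a ⟶ E, IsIso φ ∧
      ∀ x, linOf φ (R'.objEquiv a x) = F x := by
    rintro _ rfl
    exact ⟨r, hr, hrF⟩
  obtain ⟨φ, hφ, hφF⟩ := key (M.ext N z) (Rep.eq_of (fun u => (hα u).symm) fun w => (hε w).symm)
  refine ⟨z, φ, hφ, linOf_injective (LinearMap.ext fun y => ?_),
    linOf_injective (LinearMap.ext fun y => ?_)⟩
  · obtain ⟨x, rfl⟩ := (N.objEquiv a).surjective y
    rw [linOf_comp, LinearMap.comp_apply, extIncl_apply, hφF, Fn]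
  · obtain ⟨x, rfl⟩ := ((M.ext N z).objEquiv a).surjective y
    rw [linOf_comp, LinearMap.comp_apply, extProj_apply, hφF, gF]

theorem Rep.extMid_eq (L : HallAlg.Iso (A3.Mod k)) :
    HallAlg.extMid (M.obj a) (N.obj a) L =
      Rep.extCls M N a '' {z | HallAlg.isoCls ((M.ext N z).obj a) = L} := by
  ext ξ
  constructor
  · rintro ⟨E, f, g, w, h, rfl, rfl⟩
    obtain ⟨z, φ, hφ, h₁, h₂⟩ := Rep.exists_cocycle M N a h
    exact ⟨z, Quotient.sound ⟨asIso φ⟩, HallAlg.extClass_eq_of_hom _ h φ h₁ h₂⟩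
  · rintro ⟨z, hz, rfl⟩
    exact ⟨_, _, _, _, Rep.ext_shortExact M N a z, hz, rfl⟩

/-- Morphisms of representations as a kernel. -/
def Rep.homEquiv : (M.obj a ⟶ N.obj a) ≃ (M.cobound N).ker := by
  refine (Equiv.ofBijective (fun h : (M.cobound N).ker => (Rep.hom a h.1.1 h.1.2
    (fun u => ?_) (fun w => ?_) : M.obj a ⟶ N.obj a)) ⟨?_, ?_⟩).symm
  · have := congrArg (fun z : M.cocycles N => z.1.1 u) h.2
    exact (sub_eq_zero.1 this).symm
  · have := congrArg (fun z : M.cocycles N => z.1.2 w) h.2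
    exact (sub_eq_zero.1 this).symm
  · intro h h' e
    have e' : ∀ x : U × W, (h.1.1 x.1, h.1.2 x.2) = (h'.1.1 x.1, h'.1.2 x.2) := fun x =>
      (N.objEquiv a).injective (congrArg
        (fun f : M.obj a ⟶ N.obj a => linOf f (M.objEquiv a x)) e)
    refine Subtype.ext (Prod.ext (LinearMap.ext fun u => ?_) (LinearMap.ext fun w => ?_))
    · exact (Prod.mk.inj (e' (u, 0))).1
    · exact (Prod.mk.inj (e' (0, w))).2
  · intro f
    obtain ⟨σ, ω, hα, hε, rfl⟩ := Rep.exists_eq_hom a f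
    refine ⟨⟨(σ, ω), Subtype.ext (Prod.ext (LinearMap.ext fun u => ?_)
      (LinearMap.ext fun w => ?_))⟩, rfl⟩
    · exact sub_eq_zero.2 (hα u).symm
    · exact sub_eq_zero.2 (hε w).symm

end

/-- The fibres of `f` are the cosets of `H` and `S` is a union of fibres. A choice of one point in
each fibre over `f '' S` identifies `S` with `(f '' S) × H`. -/
theorem card_eq_card_image_mul {Z : Type*} {X : Type*} [AddCommGroup Z] (H : AddSubgroup Z)
    (f : Z → X) (hf : ∀ z z', f z = f z' ↔ z - z' ∈ H) (S : Set Z)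
    (hS : ∀ z z', f z = f z' → z' ∈ S → z ∈ S) : Nat.card S = Nat.card (f '' S) * Nat.card H := by
  rw [← Nat.card_prod]
  choose r hr hrf using fun x : f '' S => x.2
  refine (Nat.card_eq_of_bijective (fun p : (f '' S) × H => (⟨r p.1 + p.2, hS _ (r p.1)
    ((hf _ _).2 (by simp)) (hr p.1)⟩ : S)) ⟨?_, ?_⟩).symm
  · rintro ⟨x, h⟩ ⟨x', h'⟩ e
    have e1 : r x + h = r x' + h' := congrArg Subtype.val e
    have e2 : x = x' := by
      apply Subtype.ext
      rw [← hrf x, ← hrf x']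
      refine (hf _ _).2 ?_
      have : r x - r x' = (h' : Z) - h := by rw [sub_eq_sub_iff_add_eq_add, e1, add_comm]
      rw [this]
      exact sub_mem h'.2 h.2
    subst e2
    exact Prod.ext rfl (Subtype.ext (add_left_cancel e1))
  · rintro ⟨z, hz⟩
    have hx : f z ∈ f '' S := ⟨z, hz, rfl⟩
    refine ⟨(⟨f z, hx⟩, ⟨z - r ⟨f z, hx⟩, (hf _ _).1 (hrf ⟨f z, hx⟩).symm⟩), ?_⟩
    apply Subtype.ext
    simp

section

variable [Finite k] {U W U' W' : Type u} [AddCommGroup U] [Module k U] [AddCommGroup W]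
  [Module k W] [AddCommGroup U'] [Module k U'] [AddCommGroup W'] [Module k W']
  (M : Rep k U W) (N : Rep k U' W')
  [Module.Finite k U] [Module.Finite k W] [Module.Finite k U'] [Module.Finite k W']
  (a : Fin 2)

instance : Finite (M.cocycles N) :=
  have : Finite ((U →ₗ[k] W') × (W →ₗ[k] W')) := Module.finite_of_finite k
  inferInstance

/-- Passing from extension classes to cocycles multiplies the numerator by the order of the group of
coboundaries. The same factor turns |Hom(M, N)|, the order of the kernel of `cobound`, into the
order of its domain. -/
theorem Rep.hallNum_eq (L : HallAlg.Iso (A3.Mod k)) :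
    HallAlg.hallNum (M.obj a) (N.obj a) L =
      Nat.card {z : M.cocycles N | HallAlg.isoCls ((M.ext N z).obj a) = L} /
        Nat.card ((U →ₗ[k] U') × (W →ₗ[k] W')) := by
  have : Finite ((U →ₗ[k] U') × (W →ₗ[k] W')) := Module.finite_of_finite k
  have h₁ := card_eq_card_image_mul (M.cobound N).range (Rep.extCls M N a)
    (fun z z' => Rep.extCls_eq_iff M N a)
    {z : M.cocycles N | HallAlg.isoCls ((M.ext N z).obj a) = L}
    (fun z z' e h => (Rep.isoCls_eq_of_extCls_eq M N a e).trans h)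
  have h₂ : Nat.card ((U →ₗ[k] U') × (W →ₗ[k] W')) =
      Nat.card (M.cobound N).range * Nat.card (M.cobound N).ker := by
    rw [AddSubgroup.card_eq_card_quotient_mul_card_addSubgroup (M.cobound N).ker]
    congr 1
    exact Nat.card_congr (QuotientAddGroup.quotientKerEquivRange _).toEquiv
  have h₃ : Nat.card (M.cobound N).range ≠ 0 := Nat.card_ne_zero.2 ⟨inferInstance, inferInstance⟩
  rw [HallAlg.hallNum, Rep.extMid_eq, h₁, h₂, Nat.card_congr (Rep.homEquiv M N a), Nat.cast_mul,
    Nat.cast_mul, mul_comm (Nat.cast (Nat.card (M.cobound N).range)), mul_div_mul_right]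
  exact_mod_cast h₃

end

end IQuiver
end

/-! ### The twisted product as a sum over cocycles -/

noncomputable section

namespace HallAlg

attribute [local instance] HasDerivedCategory.standard HasExt.standard

variable {C : Type (u + 1)} [Category.{u} C] [Abelian C] (F : Type) [Field F] [CharZero F] (v : F)
  (χ : C → C → ℤ)

/-- The product of two classes, if the structure constants count the elements of a finite type. -/
theorem cls_mul_cls {M N : C} {Z : Type*} [Finite Z] (X : Z → C) (c : ℕ)
    (h : ∀ L, hallNum M N L = Nat.card {z | isoCls (X z) = L} / c) :
    cls F v χ M * cls F v χ N = (v ^ χ M N * (c : F)⁻¹) • ∑ᶠ z, cls F v χ (X z) := by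
  classical
  have := Fintype.ofFinite Z
  have key : ∑ᶠ L : Iso C, (hallNum M N L : F) • gen F L =
      (c : F)⁻¹ • ∑ z, gen F (isoCls (X z)) := by
    rw [finsum_eq_sum_of_support_subset (s := Finset.univ.image fun z => isoCls (X z))]
    -- The sum over `Z` is grouped by the isomorphism class of the middle term; the number of terms
    -- in a group is the numerator of the structure constant.
    · rw [Finset.smul_sum, ← Finset.sum_fiberwise_of_maps_to (s := Finset.univ)
        (g := fun z => isoCls (X z)) (t := Finset.univ.image fun z => isoCls (X z))
        (fun z hz => Finset.mem_image_of_mem _ hz)]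
      refine Finset.sum_congr rfl fun L _ => ?_
      rw [Finset.sum_congr rfl (g := fun _ => (c : F)⁻¹ • gen F L) fun z hz => by
        rw [(Finset.mem_filter.1 hz).2], Finset.sum_const, h, ← Nat.cast_smul_eq_nsmul F, smul_smul]
      congr 1
      rw [Nat.card_eq_fintype_card, Fintype.card_subtype]
      push_cast
      rw [div_eq_mul_inv]
      rfl
    · intro L hL
      by_contra hn
      refine hL ?_
      have : IsEmpty {z | isoCls (X z) = L} := ⟨fun z => hn (by simpa using ⟨z.1, z.2⟩)⟩
      simp [h L]
  simp only [cls]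
  rw [← map_mul, RingQuot.mkAlgHom_rel F (Rel.mul M N), key, map_smul, map_smul, map_sum, smul_smul,
    finsum_eq_sum_of_fintype]

end HallAlg

namespace IQuiver

open scoped ModuleCat

attribute [local instance] HasDerivedCategory.standard HasExt.standard

variable {k : Type u} [Field k]

theorem vEl_sq (q : ℕ) : vEl q ^ 2 = (q : QSqrt q) := by
  apply Subtype.ext
  simp only [vEl, SubmonoidClass.coe_pow, IntermediateField.AdjoinSimple.coe_gen]
  rw [Real.sq_sqrt (Nat.cast_nonneg q)]
  rfl

theorem vEl_ne_zero {q : ℕ} (h : q ≠ 0) : vEl q ≠ 0 := by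
  intro e
  have := vEl_sq q
  rw [e, zero_pow two_ne_zero] at this
  exact h (by exact_mod_cast this.symm)

section

variable {U W : Type u} [AddCommGroup U] [Module k U] [AddCommGroup W] [Module k W]
  [Module.Finite k U] [Module.Finite k W] (R : Rep k U W) (a : Fin 2)

theorem Rep.dimVec_src : A3.dimVec k (R.obj a) (A3.src a) = Module.finrank k U := by
  have : LinearMap.range (Algebra.lsmul k k (R.obj a).obj (A3.idem k (A3.src a))) =
      LinearMap.range ((R.objEquiv a).toLinearMap ∘ₗ LinearMap.inl k U W) := by
    ext y
    constructor
    · rintro ⟨x, rfl⟩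
      obtain ⟨x, rfl⟩ := (R.objEquiv a).surjective x
      exact ⟨x.1, (R.idem_src_smul a x).symm⟩
    · rintro ⟨x, rfl⟩
      exact ⟨R.objEquiv a (x, 0), R.idem_src_smul a (x, 0)⟩
  rw [dimVec, this, LinearMap.finrank_range_of_inj]
  exact (R.objEquiv a).injective.comp LinearMap.inl_injective

theorem Rep.dimVec_one : A3.dimVec k (R.obj a) 1 = Module.finrank k W := by
  have : LinearMap.range (Algebra.lsmul k k (R.obj a).obj (A3.idem k 1)) =
      LinearMap.range ((R.objEquiv a).toLinearMap ∘ₗ LinearMap.inr k U W) := by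
    ext y
    constructor
    · rintro ⟨x, rfl⟩
      obtain ⟨x, rfl⟩ := (R.objEquiv a).surjective x
      exact ⟨x.2, (R.idem_one_smul a x).symm⟩
    · rintro ⟨x, rfl⟩
      exact ⟨R.objEquiv a (0, x), R.idem_one_smul a (0, x)⟩
  rw [dimVec, this, LinearMap.finrank_range_of_inj]
  exact (R.objEquiv a).injective.comp LinearMap.inr_injective

theorem Rep.dimVec_of_ne {j : Fin 3} (h : j ≠ A3.src a) (h' : j ≠ 1) :
    A3.dimVec k (R.obj a) j = 0 := by
  have : Algebra.lsmul k k (R.obj a).obj (A3.idem k j) = 0 := by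
    ext y
    obtain ⟨x, rfl⟩ := (R.objEquiv a).surjective y
    exact R.idem_smul_of_ne a h h' x
  rw [dimVec, this, LinearMap.range_zero, finrank_bot]

end

section

variable {U W U' W' : Type u} [AddCommGroup U] [Module k U] [AddCommGroup W]
  [Module k W] [AddCommGroup U'] [Module k U'] [AddCommGroup W'] [Module k W']
  (M : Rep k U W) (N : Rep k U' W')
  [Module.Finite k U] [Module.Finite k W] [Module.Finite k U'] [Module.Finite k W']
  (a : Fin 2)

/-- The third vertex has dimension 0 in both modules, so only the arrow `a` contributes a negative
term. -/
theorem Rep.eulerRes_eq : A3.eulerRes k (M.obj a) (N.obj a) =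
    (Module.finrank k U : ℤ) * Module.finrank k U' + Module.finrank k W * Module.finrank k W' -
      Module.finrank k U * Module.finrank k W' := by
  have h1 := M.dimVec_src a
  have h2 := M.dimVec_one a
  have h3 := N.dimVec_src a
  have h4 := N.dimVec_one a
  have h5 := M.dimVec_of_ne a (j := A3.τ (A3.src a)) (by fin_cases a <;> decide)
    (by fin_cases a <;> decide)
  have h6 := N.dimVec_of_ne a (j := A3.τ (A3.src a)) (by fin_cases a <;> decide)
    (by fin_cases a <;> decide)
  rw [← h1, ← h2, ← h3, ← h4]
  fin_cases a <;> simp [A3] at h5 h6 <;>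
    simp [eulerRes, eulerForm, Fin.sum_univ_three, Fin.sum_univ_two, A3, h5, h6]
  ring

/-- The product of the classes of two representations. -/
theorem Rep.hcls_mul_hcls [Finite k] : A3.hcls k (M.obj a) * A3.hcls k (N.obj a) =
    ((vEl (Nat.card k)) ^ (Module.finrank k U * Module.finrank k U' +
      Module.finrank k W * Module.finrank k W' + Module.finrank k U * Module.finrank k W'))⁻¹ •
      ∑ᶠ z, A3.hcls k ((M.ext N z).obj a) := by
  refine (HallAlg.cls_mul_cls _ _ _ (fun z => (M.ext N z).obj a) _
    (Rep.hallNum_eq M N a)).trans ?_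
  congr 1
  have hq : Nat.card k ≠ 0 := Nat.card_ne_zero.2 ⟨inferInstance, inferInstance⟩
  have hv := vEl_ne_zero hq
  -- The denominator is q^(uu' + ww') = v^(2(uu' + ww')). Combined with the twist v^(uu' + ww' -
  -- uw') this leaves the exponent -(uu' + ww' + uw').
  rw [Rep.eulerRes_eq, Module.natCard_eq_pow_finrank (K := k)
    (V := (U →ₗ[k] U') × (W →ₗ[k] W')), Module.finrank_prod,
    Module.finrank_linearMap, Module.finrank_linearMap, Nat.cast_pow, ← vEl_sq, ← pow_mul,
    ← zpow_natCast, ← zpow_natCast, ← zpow_neg, ← zpow_neg, ← zpow_add₀ hv]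
  congr 1
  push_cast
  ring

end

end IQuiver
end

noncomputable section
namespace IQuiver

open scoped ModuleCat

attribute [local instance] HasDerivedCategory.standard HasExt.standard

variable {k : Type u} [Field k]

/-! ## Isomorphism classes of small representations -/

section

variable {X X' Y : Type*} [AddCommGroup X] [Module k X] [AddCommGroup X'] [Module k X']
  [AddCommGroup Y] [Module k Y]

/-- A linearly independent family of the right cardinality is a basis. -/
theorem exists_basis_of_linearIndependent {n : ℕ} [NeZero n] {b : Fin n → X}
    (hb : LinearIndependent k b) (h : Module.finrank k X = n) :
    ∃ B : Module.Basis (Fin n) k X, ∀ i, B i = b i :=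
  ⟨basisOfLinearIndependentOfCardEqFinrank hb (by simp [h]), fun i => by simp⟩

theorem exists_linearEquiv_of_linearIndependent {n : ℕ} [NeZero n] {b : Fin n → X}
    {b' : Fin n → X'} (hb : LinearIndependent k b) (hb' : LinearIndependent k b')
    (h : Module.finrank k X = n) (h' : Module.finrank k X' = n) :
    ∃ σ : X ≃ₗ[k] X', ∀ i, σ (b i) = b' i := by
  obtain ⟨B, hB⟩ := exists_basis_of_linearIndependent hb h
  obtain ⟨B', hB'⟩ := exists_basis_of_linearIndependent hb' h'
  exact ⟨B.equiv B' (Equiv.refl _), fun i => by rw [← hB, ← hB', B.equiv_apply]; rfl⟩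

theorem exists_linearMap_of_linearIndependent {n : ℕ} [NeZero n] {b : Fin n → X}
    (hb : LinearIndependent k b) (h : Module.finrank k X = n) (c : Fin n → Y) :
    ∃ ψ : X →ₗ[k] Y, ∀ i, ψ (b i) = c i := by
  obtain ⟨B, hB⟩ := exists_basis_of_linearIndependent hb h
  exact ⟨B.constr k c, fun i => by rw [← hB, B.constr_basis]⟩

theorem linearMap_eq_of_linearIndependent {n : ℕ} [NeZero n] {b : Fin n → X}
    (hb : LinearIndependent k b) (h : Module.finrank k X = n) {f g : X →ₗ[k] Y}
    (hfg : ∀ i, f (b i) = g (b i)) (x : X) : f x = g x := by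
  obtain ⟨B, hB⟩ := exists_basis_of_linearIndependent hb h
  exact DFunLike.congr_fun (B.ext (f₁ := f) (f₂ := g) fun i => by rw [hB, hfg]) x

theorem linearIndependent_singleton' {x : X} (hx : x ≠ 0) : LinearIndependent k ![x] :=
  linearIndependent_unique_iff.2 hx

/-- Applying ε to a relation s·εy + t·y = 0 kills the first term and gives t = 0. In dimension 2 the
pair is a Jordan basis. -/
theorem linearIndependent_of_nilpotent {ε : X →ₗ[k] X} (hε : ∀ x, ε (ε x) = 0) {y : X}
    (hy : ε y ≠ 0) : LinearIndependent k ![ε y, y] := by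
  refine LinearIndependent.pair_iff.2 fun s t h => ?_
  have h1 := congrArg ε h
  simp only [map_add, map_smul, hε, smul_zero, zero_add, map_zero, smul_eq_zero, hy,
    or_false] at h1
  subst h1
  simpa [hy] using h

theorem linearMap_exists_ne_zero {f : X →ₗ[k] Y} (h : f ≠ 0) : ∃ x, f x ≠ 0 := by
  by_contra hn
  push Not at hn
  exact h (LinearMap.ext hn)

/-- A nilpotent endomorphism of a line is zero. -/
theorem Rep.ε_eq_zero (R : Rep k Y X) (h : Module.finrank k X = 1) : R.ε = 0 := by
  by_contra hn
  obtain ⟨x, hx⟩ := linearMap_exists_ne_zero hn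
  have := Module.finite_of_finrank_eq_succ h
  have := (linearIndependent_of_nilpotent R.ε_ε hx).fintype_card_le_finrank
  simp [h] at this

end

section

variable {U W U' W' : Type u} [AddCommGroup U] [Module k U] [AddCommGroup W] [Module k W]
  [AddCommGroup U'] [Module k U'] [AddCommGroup W'] [Module k W']
  [Module.Finite k U] [Module.Finite k W] [Module.Finite k U'] [Module.Finite k W']
  (a : Fin 2) {R : Rep k U W} {R' : Rep k U' W'}

theorem Rep.hcls_eq_of_zero (hU : Module.finrank k U = Module.finrank k U')
    (hW : Module.finrank k W = Module.finrank k W') (hα : R.α = 0) (hε : R.ε = 0)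
    (hα' : R'.α = 0) (hε' : R'.ε = 0) : A3.hcls k (R.obj a) = A3.hcls k (R'.obj a) :=
  Rep.hcls_congr a R R' (LinearEquiv.ofFinrankEq _ _ hU) (LinearEquiv.ofFinrankEq _ _ hW)
    (fun u => by simp [hα, hα']) (fun w => by simp [hε, hε'])

/-- A generator x of U, together with αx completed to a basis of W, is a normal form. -/
theorem Rep.hcls_eq_of_α (hU : Module.finrank k U = 1) (hW : Module.finrank k W = 2)
    (hU' : Module.finrank k U' = 1) (hW' : Module.finrank k W' = 2) (hα : R.α ≠ 0) (hε : R.ε = 0)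
    (hα' : R'.α ≠ 0) (hε' : R'.ε = 0) : A3.hcls k (R.obj a) = A3.hcls k (R'.obj a) := by
  obtain ⟨x, hx⟩ := linearMap_exists_ne_zero hα
  obtain ⟨x', hx'⟩ := linearMap_exists_ne_zero hα'
  have h0 : LinearIndependent k ![x] := linearIndependent_singleton' (by rintro rfl; simp at hx)
  have h0' : LinearIndependent k ![x'] := linearIndependent_singleton' (by rintro rfl; simp at hx')
  obtain ⟨y, hy⟩ := exists_linearIndependent_pair_of_one_lt_finrank (R := k) (by rw [hW]; norm_num) hx
  obtain ⟨y', hy'⟩ := exists_linearIndependent_pair_of_one_lt_finrank (R := k) (by rw [hW']; norm_num) hx'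
  obtain ⟨σ, hσ⟩ := exists_linearEquiv_of_linearIndependent h0 h0' hU hU'
  obtain ⟨ω, hω⟩ := exists_linearEquiv_of_linearIndependent hy hy' hW hW'
  refine Rep.hcls_congr a R R' σ ω (linearMap_eq_of_linearIndependent h0 hU
    (f := ω.toLinearMap ∘ₗ R.α) (g := R'.α ∘ₗ σ.toLinearMap) fun i => ?_)
    (fun w => by simp [hε, hε'])
  fin_cases i
  have := hσ 0
  have := hω 0
  simp_all

theorem Rep.hcls_eq_of_ε (hU : Module.finrank k U = Module.finrank k U')
    (hW : Module.finrank k W = 2) (hW' : Module.finrank k W' = 2) (hα : R.α = 0) (hε : R.ε ≠ 0)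
    (hα' : R'.α = 0) (hε' : R'.ε ≠ 0) : A3.hcls k (R.obj a) = A3.hcls k (R'.obj a) := by
  obtain ⟨y, hy⟩ := linearMap_exists_ne_zero hε
  obtain ⟨y', hy'⟩ := linearMap_exists_ne_zero hε'
  have h1 := linearIndependent_of_nilpotent R.ε_ε hy
  have h1' := linearIndependent_of_nilpotent R'.ε_ε hy'
  obtain ⟨ω, hω⟩ := exists_linearEquiv_of_linearIndependent h1 h1' hW hW'
  refine Rep.hcls_congr a R R' (LinearEquiv.ofFinrankEq _ _ hU) ω (fun u => by simp [hα, hα'])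
    (linearMap_eq_of_linearIndependent h1 hW (f := ω.toLinearMap ∘ₗ R.ε)
      (g := R'.ε ∘ₗ ω.toLinearMap) fun i => ?_)
  have h2 := hω 0
  have h3 := hω 1
  fin_cases i <;> simp_all [R.ε_ε, R'.ε_ε]

/-- A nonzero square-zero endomorphism of a plane has its kernel equal to its image, and εα = 0 puts
αx in the kernel. -/
theorem Rep.exists_ε_eq_α (R : Rep k U W) (hW : Module.finrank k W = 2) (hε : R.ε ≠ 0) (x : U) :
    ∃ y, R.ε y = R.α x := by
  obtain ⟨y, hy⟩ := linearMap_exists_ne_zero hε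
  have h1 := linearIndependent_of_nilpotent R.ε_ε hy
  obtain ⟨B, hB⟩ := exists_basis_of_linearIndependent h1 hW
  have h2 := B.sum_repr (R.α x)
  rw [Fin.sum_univ_two, hB, hB] at h2
  have h3 := R.ε_α x
  rw [← h2] at h3
  simp only [Matrix.cons_val_zero, Matrix.cons_val_one, map_add, map_smul, R.ε_ε, smul_zero,
    zero_add, smul_eq_zero, hy, or_false] at h3
  rw [h3, zero_smul, add_zero] at h2
  exact ⟨_, (R.ε.map_smul _ y).trans h2⟩

/-- With y chosen so that εy = αx, the bases x of U and (αx, y) of W put both maps in normal form at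
once. -/
theorem Rep.hcls_eq_of_α_ε (hU : Module.finrank k U = 1) (hW : Module.finrank k W = 2)
    (hU' : Module.finrank k U' = 1) (hW' : Module.finrank k W' = 2) (hα : R.α ≠ 0) (hε : R.ε ≠ 0)
    (hα' : R'.α ≠ 0) (hε' : R'.ε ≠ 0) : A3.hcls k (R.obj a) = A3.hcls k (R'.obj a) := by
  obtain ⟨x, hx⟩ := linearMap_exists_ne_zero hα
  obtain ⟨x', hx'⟩ := linearMap_exists_ne_zero hα'
  have h0 : LinearIndependent k ![x] := linearIndependent_singleton' (by rintro rfl; simp at hx)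
  have h0' : LinearIndependent k ![x'] := linearIndependent_singleton' (by rintro rfl; simp at hx')
  obtain ⟨y, hy⟩ := R.exists_ε_eq_α hW hε x
  obtain ⟨y', hy'⟩ := R'.exists_ε_eq_α hW' hε' x'
  have h1 := linearIndependent_of_nilpotent R.ε_ε (hy.symm ▸ hx)
  have h1' := linearIndependent_of_nilpotent R'.ε_ε (hy'.symm ▸ hx')
  obtain ⟨σ, hσ⟩ := exists_linearEquiv_of_linearIndependent h0 h0' hU hU'
  obtain ⟨ω, hω⟩ := exists_linearEquiv_of_linearIndependent h1 h1' hW hW'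
  have h2 : ω (R.ε y) = R'.ε y' := hω 0
  have h3 : ω y = y' := hω 1
  have h4 : σ x = x' := hσ 0
  refine Rep.hcls_congr a R R' σ ω (linearMap_eq_of_linearIndependent h0 hU
    (f := ω.toLinearMap ∘ₗ R.α) (g := R'.α ∘ₗ σ.toLinearMap) fun i => ?_)
    (linearMap_eq_of_linearIndependent h1 hW (f := ω.toLinearMap ∘ₗ R.ε)
      (g := R'.ε ∘ₗ ω.toLinearMap) fun i => ?_)
  · fin_cases i
    simp [h4, ← hy, ← hy', h2]
  · fin_cases i
    · simp [h2, R.ε_ε, R'.ε_ε]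
    · simp [h2, h3]

/-- The normal form takes x outside ker α, a nonzero y in ker α, and αx as basis of W. The loop
vanishes on a line. -/
theorem Rep.hcls_eq_of_α' (hU : Module.finrank k U = 2) (hW : Module.finrank k W = 1)
    (hU' : Module.finrank k U' = 2) (hW' : Module.finrank k W' = 1) (hα : R.α ≠ 0)
    (hα' : R'.α ≠ 0) : A3.hcls k (R.obj a) = A3.hcls k (R'.obj a) := by
  have key : ∀ {U W : Type u} [AddCommGroup U] [Module k U] [AddCommGroup W] [Module k W]
      [Module.Finite k U] [Module.Finite k W] (R : Rep k U W), Module.finrank k U = 2 →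
      Module.finrank k W = 1 → R.α ≠ 0 →
      ∃ x y, LinearIndependent k ![x, y] ∧ LinearIndependent k ![R.α x] ∧ R.α y = 0 := by
    intro U W _ _ _ _ _ _ R hU hW hα
    obtain ⟨x, hx⟩ := linearMap_exists_ne_zero hα
    obtain ⟨y, hy, hy0⟩ := (Submodule.ne_bot_iff _).1
      (LinearMap.ker_ne_bot_of_finrank_lt (f := R.α) (by omega))
    refine ⟨x, y, LinearIndependent.pair_iff.2 fun s t h => ?_, linearIndependent_singleton' hx, hy⟩
    have h1 := congrArg R.α h
    simp only [map_add, map_smul, LinearMap.mem_ker.1 hy, smul_zero, add_zero, map_zero,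
      smul_eq_zero, hx, or_false] at h1
    subst h1
    simpa [hy0] using h
  obtain ⟨x, y, h0, h1, hy⟩ := key R hU hW hα
  obtain ⟨x', y', h0', h1', hy'⟩ := key R' hU' hW' hα'
  obtain ⟨σ, hσ⟩ := exists_linearEquiv_of_linearIndependent h0 h0' hU hU'
  obtain ⟨ω, hω⟩ := exists_linearEquiv_of_linearIndependent h1 h1' hW hW'
  have h2 : σ x = x' := hσ 0
  have h3 : σ y = y' := hσ 1
  have h4 : ω (R.α x) = R'.α x' := hω 0
  refine Rep.hcls_congr a R R' σ ω (linearMap_eq_of_linearIndependent h0 hU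
    (f := ω.toLinearMap ∘ₗ R.α) (g := R'.α ∘ₗ σ.toLinearMap) fun i => ?_)
    (fun w => by simp [R.ε_eq_zero hW, R'.ε_eq_zero hW'])
  fin_cases i
  · simp [h2, h4]
  · simp [h3, hy, hy']

/-! ## The projective module `𝔼₂` and the ideal relation -/

/-- The module is generated by `y` at the vertex 2, subject only to ε²y = 0, which holds in every
module. To lift a morphism it therefore suffices to lift the image of `y` and cut the lift down to
the vertex 2. -/
theorem Rep.projective (N : Rep k U' W') (hU : Module.finrank k U' = 0)
    (hW : Module.finrank k W' = 2) (hε : N.ε ≠ 0) : Projective (N.obj a) := by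
  obtain ⟨y, hy⟩ := linearMap_exists_ne_zero hε
  have h1 := linearIndependent_of_nilpotent N.ε_ε hy
  have : Subsingleton U' := Module.finrank_zero_iff.1 hU
  have hne := A3_src_ne_one a
  refine ⟨fun {E X} f e he => ?_⟩
  obtain ⟨x₀, hx₀⟩ := linOf_surjective e (linOf f (N.objEquiv a (0, y)))
  let x := A3.idem k 1 • x₀
  have hx1 : A3.idem k 1 • x = x := by rw [← mul_smul, idem_mul_idem]
  have hxs : A3.idem k (A3.src a) • x = 0 := by
    rw [← mul_smul, idem_mul_idem_of_ne _ _ hne, zero_smul]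
  have hee : A3.iEps k 1 • A3.iEps k 1 • x = 0 := by
    rw [← mul_smul]
    exact (congrArg (· • x) (A3.iEps_mul_iEps k 1)).trans (zero_smul _ _)
  have he1 : A3.idem k 1 • A3.iEps k 1 • x = A3.iEps k 1 • x := by
    rw [← mul_smul]
    exact congrArg (· • x) (A3.idem_mul_iEps k 1)
  have hes : A3.idem k (A3.src a) • A3.iEps k 1 • x = 0 := by
    rw [← he1, ← mul_smul, idem_mul_idem_of_ne _ _ hne, zero_smul]
  have hx : linOf e x = linOf f (N.objEquiv a (0, y)) := by
    rw [linOf_smul, hx₀, ← linOf_smul, Rep.idem_one_smul]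
  let m : A3.iAlg k → E.obj →ₗ[k] E.obj := fun r => Algebra.lsmul k k E.obj r
  have hm : ∀ r y, m r y = r • y := fun _ _ => rfl
  obtain ⟨ψ, hψ⟩ := exists_linearMap_of_linearIndependent h1 hW ![A3.iEps k 1 • x, x]
  have h2 : ψ (N.ε y) = A3.iEps k 1 • x := hψ 0
  have h3 : ψ y = x := hψ 1
  have ψ_src : ∀ w, A3.idem k (A3.src a) • ψ w = 0 :=
    linearMap_eq_of_linearIndependent h1 hW (f := m (A3.idem k (A3.src a)) ∘ₗ ψ) (g := 0)
      fun i => by fin_cases i <;> simp [hm, h2, h3, hxs, hes]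
  have ψ_one : ∀ w, A3.idem k 1 • ψ w = ψ w :=
    linearMap_eq_of_linearIndependent h1 hW (f := m (A3.idem k 1) ∘ₗ ψ) (g := ψ)
      fun i => by fin_cases i <;> simp [hm, h2, h3, hx1, he1]
  have ψ_eps : ∀ w, A3.iEps k 1 • ψ w = ψ (N.ε w) :=
    linearMap_eq_of_linearIndependent h1 hW (f := m (A3.iEps k 1) ∘ₗ ψ) (g := ψ ∘ₗ N.ε)
      fun i => by fin_cases i <;> simp [hm, h2, h3, hee, N.ε_ε]
  let φ : U' × W' →ₗ[k] E.obj := ψ ∘ₗ LinearMap.snd k U' W'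
  have hφ : ∀ p, φ p = ψ p.2 := fun _ => rfl
  have hα : ∀ u, N.α u = 0 := fun u => by rw [Subsingleton.elim u 0, map_zero]
  let F : N.obj a ⟶ E := N.desc a φ
    (fun p => by rw [hφ, hφ, ψ_src, map_zero]) (fun p => by rw [hφ, hφ, ψ_one])
    (fun p => by
      rw [hφ, hφ, hα, map_zero, ← iArr_mul_idem, mul_smul]
      exact (congrArg _ (ψ_src p.2)).trans (smul_zero _))
    (fun p => by rw [hφ, hφ, ψ_eps])
    (fun u => by rw [hφ, map_zero, smul_zero])
  have hF : ∀ p, linOf F (N.objEquiv a p) = ψ p.2 := fun _ => rfl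
  refine ⟨F, linOf_injective (LinearMap.ext fun n => ?_)⟩
  obtain ⟨⟨u, w⟩, rfl⟩ := (N.objEquiv a).surjective n
  rw [linOf_comp, LinearMap.comp_apply, hF, Subsingleton.elim u 0]
  refine linearMap_eq_of_linearIndependent h1 hW (f := linOf e ∘ₗ ψ)
    (g := linOf f ∘ₗ (N.objEquiv a).toLinearMap ∘ₗ LinearMap.inr k U' W') (fun i => ?_) w
  have h4 : linOf e (A3.iEps k 1 • x) = linOf f (N.objEquiv a (0, N.ε y)) := by
    rw [linOf_smul, hx, ← linOf_smul, Rep.iEps_one_smul]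
  fin_cases i
  · simpa [h2] using h4
  · simpa [h3] using hx

/-- The extensions of `M` by a projective module all have the same class in the localized Hall
algebra. -/
theorem Rep.hcls_ext_of_projective (M : Rep k U W) (N : Rep k U' W') [Projective (N.obj a)]
    (z z' : M.cocycles N) :
    A3.hcls k ((M.ext N z).obj a) = A3.hcls k ((M.ext N z').obj a) := by
  have hp : HasProjectiveDimensionLE (N.obj a) 0 := inferInstance
  -- Both middle terms have the K₀-class of M ⊕ N, and both become isomorphic to M in the
  -- singularity category.
  refine RingQuot.mkAlgHom_rel _ (HallAlg.Rel.ideal _ _ ?_ ?_)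
  · exact HallAlg.k0Cls_eq (Rep.ext_shortExact M N a z) (Rep.ext_shortExact M N a z') rfl rfl
  · exact HallAlg.dsg_iso (Rep.ext_shortExact M N a z) (Rep.ext_shortExact M N a z') hp hp rfl

end

/-! ## The simple modules as representations -/

section

variable {V A : Type} [Fintype V] (Q : IQuiver V A) {X : Type u} [AddCommGroup X] [Module k X]
  (g : (V × Bool) ⊕ ((A × Bool) ⊕ (V × Bool)) → Module.End k X)
  (hg : ∀ ⦃x y⦄, Q.sharp.BoundRel k (Q.SharpRel k) x y →
    FreeAlgebra.lift k g x = FreeAlgebra.lift k g y)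

/-- The underlying vector space of the restriction of a representation of `Q♯`. -/
def ofRepEquiv : X ≃ₗ[k] Q.ofRep X g hg where
  toFun x := x
  invFun x := x
  left_inv _ := rfl
  right_inv _ := rfl
  map_add' _ _ := rfl
  map_smul' c w := by
    have h : ((RingQuot.liftAlgHom k ⟨FreeAlgebra.lift k g, hg⟩).comp (Q.iAlg k).val)
        (algebraMap k _ c) = algebraMap k _ c := AlgHom.commutes _ c
    exact (congrArg (fun f : Module.End k X => f w) h).symm

theorem iGen_smul_ofRepEquiv (y : (V × Bool) ⊕ ((A × Bool) ⊕ (V × Bool))) (x : X) :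
    Q.iGen k y • ofRepEquiv Q g hg x = ofRepEquiv Q g hg ((g y + g (Q.sharpGen y)) x) := by
  have : ((RingQuot.liftAlgHom k ⟨FreeAlgebra.lift k g, hg⟩).comp (Q.iAlg k).val) (Q.iGen k y) =
      g y + g (Q.sharpGen y) := by
    simp [coe_iGen, lamGen]
  exact congrArg (fun f : Module.End k X => ofRepEquiv Q g hg (f x)) this

theorem idem_smul_ofRepEquiv {i : V} {x x' : X}
    (h : g (Sum.inl (i, false)) x + g (Sum.inl (Q.τ i, true)) x = x') :
    Q.idem k i • ofRepEquiv Q g hg x = ofRepEquiv Q g hg x' :=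
  (iGen_smul_ofRepEquiv Q g hg (Sum.inl (i, false)) x).trans (congrArg (ofRepEquiv Q g hg) h)

theorem iEps_smul_ofRepEquiv {i : V} {x x' : X}
    (h : g (Sum.inr (Sum.inr (i, false))) x + g (Sum.inr (Sum.inr (Q.τ i, true))) x = x') :
    Q.iEps k i • ofRepEquiv Q g hg x = ofRepEquiv Q g hg x' :=
  (iGen_smul_ofRepEquiv Q g hg (Sum.inr (Sum.inr (i, false))) x).trans
    (congrArg (ofRepEquiv Q g hg) h)

end

/-- The underlying vector space of a simple module. -/
def simpleEquiv (k : Type u) [Field k] (i : Fin 3) : k ≃ₗ[k] (A3.simple k i).obj :=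
  ofRepEquiv A3 (simpleGen k i) (A3.simpleGen_rel k i)

theorem idem_smul_simpleEquiv (i j : Fin 3) (x : k) :
    A3.idem k j • simpleEquiv k i x = simpleEquiv k i (if j = i then x else 0) :=
  idem_smul_ofRepEquiv A3 (simpleGen k i) (A3.simpleGen_rel k i)
    (by by_cases h : j = i <;> simp [simpleGen, h])

/-- The underlying vector space of `𝔼₂`. -/
def genSimpleEquiv (k : Type u) [Field k] : (k × k) ≃ₗ[k] (A3.genSimple k 1).obj :=
  ofRepEquiv A3 (genSimpleGen k 1) (A3.genSimpleGen_rel k 1)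

theorem idem_smul_genSimpleEquiv (j : Fin 3) (x : k × k) :
    A3.idem k j • genSimpleEquiv k x = genSimpleEquiv k (if j = 1 then x else 0) :=
  idem_smul_ofRepEquiv A3 (genSimpleGen k 1) (A3.genSimpleGen_rel k 1)
    (by fin_cases j <;> simp [genSimpleGen, A3])

theorem iEps_smul_genSimpleEquiv (x : k × k) :
    A3.iEps k 1 • genSimpleEquiv k x = genSimpleEquiv k (0, x.1) :=
  iEps_smul_ofRepEquiv A3 (genSimpleGen k 1) (A3.genSimpleGen_rel k 1)
    (by simp [genSimpleGen, A3])

section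

variable {U W : Type u} [AddCommGroup U] [Module k U] [AddCommGroup W] [Module k W]
  [Module.Finite k U] [Module.Finite k W] (a : Fin 2)

/-- The last clause keeps track of the loop; it serves to see that ε ≠ 0 on 𝔼₂. -/
theorem exists_rep_hcls_eq {E : A3.Mod k} (φ : (U × W) ≃ₗ[k] E.obj)
    (hs : ∀ x, A3.idem k (A3.src a) • φ x = φ (x.1, 0))
    (h1 : ∀ x, A3.idem k 1 • φ x = φ (0, x.2)) :
    ∃ R : Rep k U W, A3.hcls k E = A3.hcls k (R.obj a) ∧
      ∀ w, A3.iEps k 1 • φ (0, w) = φ (0, R.ε w) := by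
  obtain ⟨R, f, hf, hfφ⟩ := exists_rep a φ hs h1
  refine ⟨R, (hcls_congr (asIso f)).symm, fun w => ?_⟩
  rw [← hfφ, ← hfφ, ← linOf_smul, Rep.iEps_one_smul]

end

theorem exists_rep_simple_src (a : Fin 2) : ∃ R : Rep k k PUnit.{u + 1},
    A3.hcls k (A3.simple k (A3.src a)) = A3.hcls k (R.obj a) := by
  obtain ⟨R, hR, -⟩ := exists_rep_hcls_eq a
    ((LinearEquiv.prodUnique : (k × PUnit.{u + 1}) ≃ₗ[k] k) ≪≫ₗ simpleEquiv k (A3.src a))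
    (fun x => by simp [idem_smul_simpleEquiv])
    (fun x => by simp [idem_smul_simpleEquiv, (A3_src_ne_one a).symm])
  exact ⟨R, hR⟩

theorem exists_rep_simple_one (a : Fin 2) : ∃ R : Rep k PUnit.{u + 1} k,
    A3.hcls k (A3.simple k 1) = A3.hcls k (R.obj a) := by
  obtain ⟨R, hR, -⟩ := exists_rep_hcls_eq a
    ((LinearEquiv.uniqueProd : (PUnit.{u + 1} × k) ≃ₗ[k] k) ≪≫ₗ simpleEquiv k 1)
    (fun x => by simp [idem_smul_simpleEquiv, A3_src_ne_one a])
    (fun x => by simp [idem_smul_simpleEquiv])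
  exact ⟨R, hR⟩

theorem exists_rep_genSimple_one (a : Fin 2) : ∃ R : Rep k PUnit.{u + 1} (k × k), R.ε ≠ 0 ∧
    A3.hcls k (A3.genSimple k 1) = A3.hcls k (R.obj a) := by
  obtain ⟨R, hR, hε⟩ := exists_rep_hcls_eq a
    ((LinearEquiv.uniqueProd : (PUnit.{u + 1} × (k × k)) ≃ₗ[k] (k × k)) ≪≫ₗ genSimpleEquiv k)
    (fun x => by simp [idem_smul_genSimpleEquiv, A3_src_ne_one a])
    (fun x => by simp [idem_smul_genSimpleEquiv])
  refine ⟨R, fun h0 => ?_, hR⟩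
  have := hε (1, 0)
  simp [iEps_smul_genSimpleEquiv, h0] at this

end IQuiver
end

noncomputable section
namespace IQuiver

open scoped ModuleCat

attribute [local instance] HasDerivedCategory.standard HasExt.standard

/-! ## Products of classes of small representations -/

theorem finsum_eq_add_smul {F H X : Type*} [Ring F] [AddCommGroup H] [Module F H] [Finite X]
    [Zero X] (f : X → H) (b : H) (h : ∀ x, x ≠ 0 → f x = b) :
    ∑ᶠ x, f x = f 0 + ((Nat.card X : F) - 1) • b := by
  classical
  have := Fintype.ofFinite X
  rw [finsum_eq_sum_of_fintype, ← Finset.add_sum_erase _ _ (Finset.mem_univ (0 : X)),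
    Finset.sum_congr rfl (g := fun _ => b) (fun x hx => h x (Finset.ne_of_mem_erase hx)),
    Finset.sum_const, Finset.card_erase_of_mem (Finset.mem_univ _), Finset.card_univ,
    Nat.card_eq_fintype_card, ← Nat.cast_smul_eq_nsmul F,
    Nat.cast_sub (Fintype.card_pos_iff.2 ⟨0⟩), Nat.cast_one]

theorem finsum_prod_eq_add_smul {F H X Y : Type*} [Ring F] [AddCommGroup H] [Module F H]
    [Finite X] [Zero X] [Finite Y] [Zero Y] (f : X × Y → H) (b c d : H)
    (hb : ∀ y, y ≠ 0 → f (0, y) = b) (hc : ∀ x, x ≠ 0 → f (x, 0) = c)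
    (hd : ∀ x y, x ≠ 0 → y ≠ 0 → f (x, y) = d) :
    ∑ᶠ x, f x = f (0, 0) + ((Nat.card Y : F) - 1) • b +
      ((Nat.card X : F) - 1) • (c + ((Nat.card Y : F) - 1) • d) := by
  have h1 : ∑ᶠ x, f x = ∑ᶠ x, ∑ᶠ y, f (x, y) := by
    have := Fintype.ofFinite X
    have := Fintype.ofFinite Y
    simp only [finsum_eq_sum_of_fintype, Fintype.sum_prod_type]
  rw [h1, finsum_eq_add_smul (F := F) _ (c + ((Nat.card Y : F) - 1) • d) fun x hx => ?_,
    finsum_eq_add_smul (F := F) _ b hb]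
  rw [finsum_eq_add_smul (F := F) _ d fun y hy => hd x y hx hy, hc x hx]

variable (k : Type u) [Field k]

/-- The representation of dimension vector `(m, n)` in which the arrows act by `0`. -/
def zeroRep (m n : ℕ) : Rep k (Fin m → k) (Fin n → k) := ⟨0, 0, fun _ => rfl, fun _ => rfl⟩

variable (a : Fin 2)

/-- The class of the semisimple module of dimension vector `(m, n)`. -/
def zcls (m n : ℕ) : A3.IHall k := A3.hcls k ((zeroRep k m n).obj a)

variable {k}

theorem Rep.hcls_eq_zcls {U W : Type u} [AddCommGroup U] [Module k U] [AddCommGroup W]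
    [Module k W] [Module.Finite k U] [Module.Finite k W] {m n : ℕ} (R : Rep k U W)
    (hU : Module.finrank k U = m) (hW : Module.finrank k W = n) (hα : R.α = 0) (hε : R.ε = 0) :
    A3.hcls k (R.obj a) = zcls k a m n :=
  Rep.hcls_eq_of_zero a (by simp [hU]) (by simp [hW]) hα hε rfl rfl

/-- The extensions of semisimple modules. -/
def zeroRepCocycles (m n m' n' : ℕ) :
    ((Fin m → k) →ₗ[k] (Fin n' → k)) × ((Fin n → k) →ₗ[k] (Fin n' → k)) ≃
      (zeroRep k m n).cocycles (zeroRep k m' n') where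
  toFun z := ⟨z, fun _ => (zero_add _).trans (map_zero _), fun _ => (zero_add _).trans (map_zero _)⟩
  invFun z := z.1
  left_inv _ := rfl
  right_inv _ := rfl

theorem natCard_fun_linearMap [Finite k] (m n : ℕ) :
    Nat.card ((Fin m → k) →ₗ[k] (Fin n → k)) = Nat.card k ^ (m * n) := by
  rw [Module.natCard_eq_pow_finrank (K := k), Module.finrank_linearMap, Module.finrank_fin_fun,
    Module.finrank_fin_fun]

theorem linearMap_eq_zero_of_mul_eq_zero {m n : ℕ} (h : m * n = 0)
    (f : (Fin m → k) →ₗ[k] (Fin n → k)) : f = 0 := by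
  rcases Nat.mul_eq_zero.1 h with rfl | rfl <;> exact Subsingleton.elim _ _

/-- Both modules have zero arrows, so every pair of blocks (f, g) is a cocycle, and the middle term
has α = 0 iff f = 0 and ε = 0 iff g = 0. The four cases give the four terms. Where a block space is
zero its coefficient vanishes and no condition is imposed on the class, so the applications below
put 0 there. -/
theorem zcls_mul [Finite k] {m n m' n' : ℕ} (b c d : A3.IHall k)
    (hb : n * n' ≠ 0 → ∀ R : Rep k ((Fin m' → k) × (Fin m → k)) ((Fin n' → k) × (Fin n → k)),
      R.α = 0 → R.ε ≠ 0 → A3.hcls k (R.obj a) = b)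
    (hc : m * n' ≠ 0 → ∀ R : Rep k ((Fin m' → k) × (Fin m → k)) ((Fin n' → k) × (Fin n → k)),
      R.α ≠ 0 → R.ε = 0 → A3.hcls k (R.obj a) = c)
    (hd : n * n' ≠ 0 → m * n' ≠ 0 →
      ∀ R : Rep k ((Fin m' → k) × (Fin m → k)) ((Fin n' → k) × (Fin n → k)),
      R.α ≠ 0 → R.ε ≠ 0 → A3.hcls k (R.obj a) = d) :
    zcls k a m n * zcls k a m' n' =
      (vEl (Nat.card k) ^ (m * m' + n * n' + m * n'))⁻¹ • (zcls k a (m' + m) (n' + n) +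
        ((Nat.card k : QSqrt (Nat.card k)) ^ (n * n') - 1) • b +
        ((Nat.card k : QSqrt (Nat.card k)) ^ (m * n') - 1) •
          (c + ((Nat.card k : QSqrt (Nat.card k)) ^ (n * n') - 1) • d)) := by
  have hα : ∀ f g, ((zeroRep k m n).ext _ (zeroRepCocycles m n m' n' (f, g))).α = 0 ↔ f = 0 := by
    refine fun f g => ⟨fun h => LinearMap.ext fun u => ?_, ?_⟩
    · exact (zero_add _).symm.trans (congrArg Prod.fst (DFunLike.congr_fun h (0, u)))
    · rintro rfl
      exact LinearMap.ext fun u => Prod.ext (zero_add _) rfl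
  have hε : ∀ f g, ((zeroRep k m n).ext _ (zeroRepCocycles m n m' n' (f, g))).ε = 0 ↔ g = 0 := by
    refine fun f g => ⟨fun h => LinearMap.ext fun u => ?_, ?_⟩
    · exact (zero_add _).symm.trans (congrArg Prod.fst (DFunLike.congr_fun h (0, u)))
    · rintro rfl
      exact LinearMap.ext fun u => Prod.ext (zero_add _) rfl
  have hfin : ∀ m n, Finite ((Fin m → k) →ₗ[k] (Fin n → k)) := fun m n =>
    Module.finite_of_finite k
  have hf : ∀ {m}, ∀ f : (Fin m → k) →ₗ[k] (Fin n' → k), f ≠ 0 → m * n' ≠ 0 :=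
    fun f hf h => hf (linearMap_eq_zero_of_mul_eq_zero h f)
  refine (Rep.hcls_mul_hcls _ _ a).trans ?_
  rw [← finsum_comp_equiv (zeroRepCocycles m n m' n'),
    finsum_prod_eq_add_smul (F := QSqrt (Nat.card k)) _ b c d
    (fun g hg => hb (hf g hg) _ ((hα _ _).2 rfl) ((hε _ _).not.2 hg))
    (fun f h => hc (hf f h) _ ((hα _ _).not.2 h) ((hε _ _).2 rfl))
    (fun f g h hg => hd (hf g hg) (hf f h) _ ((hα _ _).not.2 h) ((hε _ _).not.2 hg)),
    natCard_fun_linearMap, natCard_fun_linearMap, Rep.hcls_eq_zcls a _ _ _ ((hα _ _).2 rfl)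
    ((hε _ _).2 rfl) (m := m' + m) (n := n' + n)]
  · simp only [Module.finrank_fin_fun, Nat.cast_pow]
  · simp
  · simp

/-- The product with a representation supported at the source of the arrow. -/
theorem Rep.hcls_mul_hcls_of_subsingleton [Finite k] {U W U' W' : Type u} [AddCommGroup U]
    [Module k U] [AddCommGroup W] [Module k W] [AddCommGroup U'] [Module k U'] [AddCommGroup W']
    [Module k W'] [Module.Finite k U] [Module.Finite k W] [Module.Finite k U']
    [Subsingleton W'] (M : Rep k U W) (N : Rep k U' W') :
    A3.hcls k (M.obj a) * A3.hcls k (N.obj a) =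
      (vEl (Nat.card k) ^ (Module.finrank k U * Module.finrank k U'))⁻¹ •
        A3.hcls k ((M.ext N 0).obj a) := by
  have : Subsingleton (M.cocycles N) := inferInstance
  rw [Rep.hcls_mul_hcls, finsum_eq_single _ 0 fun z hz => (hz (Subsingleton.elim _ _)).elim,
    Module.finrank_zero_of_subsingleton (R := k) (M := W'), mul_zero, mul_zero, add_zero, add_zero]

/-- The representation in which `α` is the inclusion of the first coordinate, and `ε = 0`. -/
def repα : Rep k k (k × k) := ⟨LinearMap.inl k k k, 0, fun _ => rfl, fun _ => rfl⟩

/-- The representation in which `α = 0` and `ε` maps the second coordinate to the first. -/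
def repε (U : Type u) [AddCommGroup U] [Module k U] : Rep k U (k × k) :=
  ⟨0, LinearMap.inl k k k ∘ₗ LinearMap.snd k k k, fun _ => rfl, fun _ => rfl⟩

/-- The representation of dimension vector `(2, 1)` in which `α` is the first projection. -/
def repα' : Rep k (k × k) k := ⟨LinearMap.fst k k k, 0, fun _ => rfl, fun _ => rfl⟩

theorem repα_α : (repα : Rep k k (k × k)).α ≠ 0 := fun h =>
  one_ne_zero (congrArg Prod.fst (DFunLike.congr_fun h 1))

theorem repε_ε (U : Type u) [AddCommGroup U] [Module k U] : (repε U : Rep k U (k × k)).ε ≠ 0 :=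
  fun h => one_ne_zero (congrArg Prod.fst (DFunLike.congr_fun h (0, 1)))

theorem repα'_α : (repα' : Rep k (k × k) k).α ≠ 0 := fun h =>
  one_ne_zero (DFunLike.congr_fun h (1, 0))

variable (k) in
/-- The cocycle of the extension of `S` by `𝔼₂` in which `α` is the multiplication by `t`. -/
def repεCocycle : k ≃ (zeroRep k 1 0).cocycles (repε PUnit.{u + 1}) where
  toFun t := ⟨(LinearMap.inl k k k ∘ₗ (t • LinearMap.proj 0), 0), fun _ => by simp [repε],
    fun _ => by simp [repε]⟩
  invFun z := (z.1.1 fun _ => 1).1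
  left_inv t := by simp
  right_inv z := by
    refine Subtype.ext (Prod.ext (LinearMap.ext fun u => ?_) (Subsingleton.elim _ _))
    -- The cocycle condition forces the image of the new arrow into ker ε, the first coordinate
    -- line; hence there are q cocycles and not q².
    have h1 : ((z.1.1 u).2, (0 : k)) + z.1.2 0 = 0 := z.2.1 u
    have h2 : u = u 0 • fun _ => 1 := by ext i; fin_cases i; simp
    rw [map_zero, add_zero] at h1
    refine Prod.ext ?_ (congrArg Prod.fst h1).symm
    conv_rhs => rw [h2, map_smul]
    simp [mul_comm]

theorem ext_repεCocycle_α (t : k) (u : PUnit.{u + 1} × (Fin 1 → k)) :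
    ((zeroRep k 1 0).ext (repε PUnit.{u + 1}) (repεCocycle k t)).α u =
      ((0 + t * u.2 0, 0 + 0), 0) := rfl

theorem ext_repεCocycle_ε (t : k) (w : (k × k) × (Fin 0 → k)) :
    ((zeroRep k 1 0).ext (repε PUnit.{u + 1}) (repεCocycle k t)).ε w =
      ((w.1.2 + 0, 0 + 0), 0) := rfl

theorem ext_repεCocycle_α_eq_zero_iff {t : k} :
    ((zeroRep k 1 0).ext (repε PUnit.{u + 1}) (repεCocycle k t)).α = 0 ↔ t = 0 := by
  constructor
  · intro h
    have := congrArg (fun p => p.1.1) (DFunLike.congr_fun h (0, fun _ => 1))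
    simpa [ext_repεCocycle_α] using this
  · rintro rfl
    exact LinearMap.ext fun u => by simp [ext_repεCocycle_α]

theorem ext_repεCocycle_ε_ne_zero (t : k) :
    ((zeroRep k 1 0).ext (repε PUnit.{u + 1}) (repεCocycle k t)).ε ≠ 0 := by
  intro h
  have := congrArg (fun p => p.1.1) (DFunLike.congr_fun h ((0, 1), 0))
  simp [ext_repεCocycle_ε] at this

end IQuiver
end

/-! ### The products of simple classes and the two identities -/

noncomputable section
namespace IQuiver

variable {k : Type u} [Field k] (a : Fin 2)

@[simp]
theorem finrank_pUnit : Module.finrank k PUnit.{u + 1} = 0 :=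
  Module.finrank_zero_of_subsingleton

/-- If α ≠ 0, the module is the nonsplit extension of S_i by 𝔼₂, and the projectivity of 𝔼₂ lets the
ideal relation replace it by the split one. This identification of two nonisomorphic modules is the
only use of the ideal. -/
theorem Rep.hcls_eq_hcls_repε {U W : Type u} [AddCommGroup U] [Module k U] [AddCommGroup W]
    [Module k W] [Module.Finite k U] [Module.Finite k W] (R : Rep k U W)
    (hU : Module.finrank k U = 1) (hW : Module.finrank k W = 2) (hε : R.ε ≠ 0) :
    A3.hcls k (R.obj a) = A3.hcls k ((repε k).obj a) := by
  by_cases hα : R.α = 0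
  · exact Rep.hcls_eq_of_ε a (by simp [hU]) hW (by simp) hα hε rfl (repε_ε k)
  have := (repε PUnit.{u + 1} : Rep k PUnit (k × k)).projective a (by simp) (by simp) (repε_ε _)
  rw [Rep.hcls_eq_of_α_ε a (R' := (zeroRep k 1 0).ext (repε PUnit.{u + 1}) (repεCocycle k 1))
    hU hW (by simp) (by simp) hα hε (ext_repεCocycle_α_eq_zero_iff.not.2 one_ne_zero)
    (ext_repεCocycle_ε_ne_zero 1), Rep.hcls_ext_of_projective a _ _ _ (repεCocycle k 0)]
  exact Rep.hcls_eq_of_ε a (by simp) (by simp) (by simp) (ext_repεCocycle_α_eq_zero_iff.2 rfl)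
    (ext_repεCocycle_ε_ne_zero 0) rfl (repε_ε k)

theorem hcls_simple_src : A3.hcls k (A3.simple k (A3.src a)) = zcls k a 1 0 := by
  obtain ⟨R, hR⟩ := exists_rep_simple_src (k := k) a
  rw [hR, R.hcls_eq_zcls a (m := 1) (n := 0) (by simp) (by simp) (Subsingleton.elim _ _) (Subsingleton.elim _ _)]

theorem hcls_simple_one : A3.hcls k (A3.simple k 1) = zcls k a 0 1 := by
  obtain ⟨R, hR⟩ := exists_rep_simple_one (k := k) a
  rw [hR, R.hcls_eq_zcls a (m := 0) (n := 1) (by simp) (by simp) (Subsingleton.elim _ _) (R.ε_eq_zero (by simp))]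

theorem hcls_genSimple_one :
    A3.hcls k (A3.genSimple k 1) = A3.hcls k ((repε PUnit.{u + 1}).obj a) := by
  obtain ⟨R, hε, hR⟩ := exists_rep_genSimple_one (k := k) a
  rw [hR, Rep.hcls_eq_of_ε a (R' := repε PUnit.{u + 1}) rfl (by simp) (by simp)
    (Subsingleton.elim _ _) hε rfl (repε_ε _)]

variable [Finite k]

/-- `[S₁] * [𝔼₂]` -/
theorem zcls_mul_hcls_repε :
    zcls k a 1 0 * A3.hcls k ((repε PUnit.{u + 1}).obj a) = A3.hcls k ((repε k).obj a) := by
  have hq : Nat.card k ≠ 0 := Nat.card_ne_zero.2 ⟨inferInstance, inferInstance⟩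
  refine (Rep.hcls_mul_hcls _ _ a).trans ?_
  -- All q cocycles give the same class, and the factor q cancels the normalization v^{-2}.
  rw [← finsum_comp_equiv (repεCocycle k), finsum_eq_add_smul (F := QSqrt (Nat.card k)) _
    (A3.hcls k ((repε k).obj a)) fun t _ => Rep.hcls_eq_hcls_repε a _ (by simp) (by simp)
      (ext_repεCocycle_ε_ne_zero t), Rep.hcls_eq_hcls_repε a _ (by simp) (by simp)
      (ext_repεCocycle_ε_ne_zero 0)]
  have hv := vEl_ne_zero hq
  simp only [Module.finrank_fin_fun, Module.finrank_prod, Module.finrank_self,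
    finrank_pUnit, ← vEl_sq]
  match_scalars
  field_simp
  ring

/-- `[𝔼₂] * [S₁]` -/
theorem hcls_repε_mul_zcls :
    A3.hcls k ((repε PUnit.{u + 1}).obj a) * zcls k a 1 0 = A3.hcls k ((repε k).obj a) := by
  refine (Rep.hcls_mul_hcls_of_subsingleton a _ _).trans ?_
  rw [finrank_pUnit, zero_mul, pow_zero,
    inv_one, one_smul]
  refine Rep.hcls_eq_hcls_repε a _ (by simp) (by simp) fun h => one_ne_zero (α := k) ?_
  exact congrArg (fun p => p.2.1) (DFunLike.congr_fun h (0, (0, 1)))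

/-- `[S_i] * [S_i]` for the source `i` of an arrow -/
theorem zcls_one_zero_mul_zcls_one_zero :
    zcls k a 1 0 * zcls k a 1 0 = (vEl (Nat.card k))⁻¹ • zcls k a 2 0 := by
  rw [zcls_mul a 0 0 0 (by simp) (by simp) (by simp)]
  simp

theorem zcls_two_zero_mul_zcls_zero_one :
    zcls k a 2 0 * zcls k a 0 1 = (vEl (Nat.card k) ^ 2)⁻¹ • (zcls k a 2 1 +
      ((Nat.card k : QSqrt (Nat.card k)) ^ 2 - 1) • A3.hcls k (repα'.obj a)) := by
  rw [zcls_mul a 0 (A3.hcls k (repα'.obj a)) 0 (by simp) (fun _ R hα _ =>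
    Rep.hcls_eq_of_α' a (by simp) (by simp) (by simp) (by simp) hα repα'_α) (by simp)]
  simp

/-- Nothing leads from the vertex 2 to i, so the only extension is the split one, and the exponent
of v is 0. -/
theorem zcls_zero_one_mul_zcls_one_zero : zcls k a 0 1 * zcls k a 1 0 = zcls k a 1 1 := by
  rw [zcls_mul a 0 0 0 (by simp) (by simp) (by simp)]
  simp

theorem zcls_one_zero_mul_zcls_one_one :
    zcls k a 1 0 * zcls k a 1 1 = (vEl (Nat.card k) ^ 2)⁻¹ • (zcls k a 2 1 +
      ((Nat.card k : QSqrt (Nat.card k)) - 1) • A3.hcls k (repα'.obj a)) := by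
  rw [zcls_mul a 0 (A3.hcls k (repα'.obj a)) 0 (by simp) (fun _ R hα _ =>
    Rep.hcls_eq_of_α' a (by simp) (by simp) (by simp) (by simp) hα repα'_α) (by simp)]
  simp

theorem zcls_zero_one_mul_zcls_two_zero : zcls k a 0 1 * zcls k a 2 0 = zcls k a 2 1 := by
  rw [zcls_mul a 0 0 0 (by simp) (by simp) (by simp)]
  simp

theorem zcls_zero_one_mul_zcls_zero_one :
    zcls k a 0 1 * zcls k a 0 1 = (vEl (Nat.card k))⁻¹ • (zcls k a 0 2 +
      ((Nat.card k : QSqrt (Nat.card k)) - 1) • A3.hcls k ((repε PUnit.{u + 1}).obj a)) := by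
  rw [zcls_mul a (A3.hcls k ((repε PUnit.{u + 1}).obj a)) 0 0 (fun _ R hα hε =>
    Rep.hcls_eq_of_ε a (by simp) (by simp) (by simp) hα hε rfl (repε_ε _)) (by simp) (by simp)]
  simp

theorem zcls_zero_two_mul_zcls_one_zero : zcls k a 0 2 * zcls k a 1 0 = zcls k a 1 2 := by
  rw [zcls_mul a 0 0 0 (by simp) (by simp) (by simp)]
  simp

theorem zcls_one_zero_mul_zcls_zero_two :
    zcls k a 1 0 * zcls k a 0 2 = (vEl (Nat.card k) ^ 2)⁻¹ • (zcls k a 1 2 +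
      ((Nat.card k : QSqrt (Nat.card k)) ^ 2 - 1) • A3.hcls k (repα.obj a)) := by
  rw [zcls_mul a 0 (A3.hcls k (repα.obj a)) 0 (by simp) (fun _ R hα hε =>
    Rep.hcls_eq_of_α a (by simp) (by simp) (by simp) (by simp) hα hε repα_α rfl) (by simp)]
  simp

/-- Among the q² cocycles, q - 1 have ε ≠ 0 and α = 0, and (q - 1)² have both nonzero. All of these
share one class, with total weight q(q - 1). -/
theorem zcls_one_one_mul_zcls_zero_one :
    zcls k a 1 1 * zcls k a 0 1 = (vEl (Nat.card k) ^ 2)⁻¹ • (zcls k a 1 2 +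
      ((Nat.card k : QSqrt (Nat.card k)) - 1) • A3.hcls k ((repε k).obj a) +
      ((Nat.card k : QSqrt (Nat.card k)) - 1) • (A3.hcls k (repα.obj a) +
        ((Nat.card k : QSqrt (Nat.card k)) - 1) • A3.hcls k ((repε k).obj a))) := by
  rw [zcls_mul a (A3.hcls k ((repε k).obj a)) (A3.hcls k (repα.obj a)) (A3.hcls k ((repε k).obj a))
    (fun _ R hα hε => R.hcls_eq_hcls_repε a (by simp) (by simp) hε) (fun _ R hα hε =>
    Rep.hcls_eq_of_α a (by simp) (by simp) (by simp) (by simp) hα hε repα_α rfl)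
    (fun _ _ R hα hε => R.hcls_eq_hcls_repε a (by simp) (by simp) hε)]
  simp

theorem serre_src :
    zcls k a 1 0 * zcls k a 1 0 * zcls k a 0 1 -
      (vEl (Nat.card k) + (vEl (Nat.card k))⁻¹) • (zcls k a 1 0 * zcls k a 0 1 * zcls k a 1 0) +
      zcls k a 0 1 * zcls k a 1 0 * zcls k a 1 0 = 0 := by
  have hq : Nat.card k ≠ 0 := Nat.card_ne_zero.2 ⟨inferInstance, inferInstance⟩
  have hv := vEl_ne_zero hq
  rw [mul_assoc (zcls k a 1 0) (zcls k a 0 1), mul_assoc (zcls k a 0 1),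
    zcls_one_zero_mul_zcls_one_zero, zcls_zero_one_mul_zcls_one_zero,
    zcls_one_zero_mul_zcls_one_one, smul_mul_assoc, mul_smul_comm,
    zcls_two_zero_mul_zcls_zero_one, zcls_zero_one_mul_zcls_two_zero, ← vEl_sq]
  -- Two coefficients are compared, those of the semisimple module and of the module with α ≠ 0; the
  -- second rests on q² - 1 = (q + 1)(q - 1) with q = v².
  match_scalars <;> field_simp <;> ring

theorem serre_tgt :
    zcls k a 0 1 * zcls k a 0 1 * zcls k a 1 0 -
      (vEl (Nat.card k) + (vEl (Nat.card k))⁻¹) • (zcls k a 0 1 * zcls k a 1 0 * zcls k a 0 1) +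
      zcls k a 1 0 * zcls k a 0 1 * zcls k a 0 1 =
    -(((Nat.card k : QSqrt (Nat.card k)) - 1) ^ 2 / vEl (Nat.card k)) •
      (zcls k a 1 0 * A3.hcls k ((repε PUnit.{u + 1}).obj a)) := by
  have hq : Nat.card k ≠ 0 := Nat.card_ne_zero.2 ⟨inferInstance, inferInstance⟩
  have hv := vEl_ne_zero hq
  rw [mul_assoc (zcls k a 1 0), zcls_zero_one_mul_zcls_one_zero, zcls_zero_one_mul_zcls_zero_one,
    zcls_one_one_mul_zcls_zero_one, smul_mul_assoc, mul_smul_comm, add_mul, mul_add,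
    smul_mul_assoc, mul_smul_comm, zcls_zero_two_mul_zcls_one_zero, hcls_repε_mul_zcls,
    zcls_one_zero_mul_zcls_zero_two, zcls_mul_hcls_repε, ← vEl_sq]
  -- The classes of the semisimple module and of the module with α ≠ 0, ε = 0 cancel. For the class
  -- of S_i ⊕ 𝔼₂ the outer products give 2(q - 1)/v and the middle one (v + v^{-1})(q - 1), so (q -
  -- 1)(v^{-1} - v) is left.
  match_scalars <;> field_simp <;> ring

end IQuiver
end

theorem mainTheorem12 (k : Type u) [Field k] [Finite k] (i : Fin 3) (hi : i = 0 ∨ i = 2) :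
    let q : ℕ := Nat.card k
    let v : IQuiver.QSqrt q := IQuiver.vEl q
    let S : Fin 3 → IQuiver.A3.IHall k := fun j => IQuiver.A3.hcls k (IQuiver.A3.simple k j)
    let E : Fin 3 → IQuiver.A3.IHall k := fun j => IQuiver.A3.hcls k (IQuiver.A3.genSimple k j)
    S i * S i * S 1 - (v + v⁻¹) • (S i * S 1 * S i) + S 1 * S i * S i = 0 ∧
    S 1 * S 1 * S i - (v + v⁻¹) • (S 1 * S i * S 1) + S i * S 1 * S 1 =
      -(((q : IQuiver.QSqrt q) - 1) ^ 2 / v) • (S i * E 1) := by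
  intro q v S E
  -- The vertices 1 and 3 are the sources of the two arrows, and everything above is uniform in the
  -- arrow.
  obtain ⟨a, rfl⟩ : ∃ a, IQuiver.A3.src a = i := by
    rcases hi with rfl | rfl
    · exact ⟨0, rfl⟩
    · exact ⟨1, rfl⟩
  simp only [S, E, IQuiver.hcls_simple_src a, IQuiver.hcls_simple_one a,
    IQuiver.hcls_genSimple_one a]
  exact ⟨IQuiver.serre_src a, IQuiver.serre_tgt a⟩
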